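/- **Setting.** Let $n\ge 1$, identify $\mathbb H^n\cong\mathbb R^{4n}$ by $q_l=x_{4l}+\mathbf i x_{4l+1}+\mathbf j x_{4l+2}+\mathbf k x_{4l+3}$ ($0\le l\le n-1$), and let $\Omega\subset\mathbb H^n$ be open. A function $u:\Omega\to[-\infty,\infty)$ is *plurisubharmonic* (PSH) if it is upper semicontinuous and its restriction to (the part in $\Omega$ of) each right quaternionic line $\{a+v\lambda:\lambda\in\mathbb H\}$, $v\neq0$, is subharmonic, i.e. satisfies the sub-mean value inequality for spheres bounding closed balls ($\equiv-\infty$ being allowed on a line). Let $\omega^0,\dots,\omega^{2n-1}$ be the standard basis of $\mathbb C^{2n}$, $\Omega_{2n}=\omega^0\wedge\dots\wedge\omega^{2n-1}$, and $$\nabla_{(2l)0}=\partial_{x_{4l}}+i\partial_{x_{4l+1}},\quad \nabla_{(2l)1}=-\partial_{x_{4l+2}}-i\partial_{x_{4l+3}},\quad \nabla_{(2l+1)0}=\partial_{x_{4l+2}}-i\partial_{x_{4l+3}},\quad \nabla_{(2l+1)1}=\partial_{x_{4l}}-i\partial_{x_{4l+1}}.$$ For a form $F=\sum_I f_I\omega^I$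 with values in $\wedge^p\mathbb C^{2n}$ put $d_\alpha F=\sum_{k,I}\nabla_{k\alpha}f_I\,\omega^k\wedge\omega^I$ ($\alpha=0,1$) and $\triangle F=d_0d_1F$. A *$p$-current* is a continuous linear functional on the space $\mathcal D^{2n-p}(\Omega)=C_0^\infty(\Omega,\wedge^{2n-p}\mathbb C^{2n})$ of test forms; $(d_\alpha T)(\eta)=-T(d_\alpha\eta)$ and $(\triangle T)(\eta)=T(\triangle\eta)$, and $T$ is *closed* if $d_0T=d_1T=0$. A locally integrable $p$-form $\psi$ defines the $p$-current $T_\psi(\varphi)=\int_\Omega\psi\wedge\varphi$, where $\int_\Omega f\,\Omega_{2n}:=\int_\Omega f\,dV$. For a right $\mathbb H$-linear map $\eta:\mathbb H^n\to\mathbb H$, $\eta(q)=\sum_l a_lq_l$, let $\eta^*\tilde\omega^\varepsilon=\sum_{l}\sum_{\delta\in\{0,1\}}\tau(a_l)_{\varepsilon\delta}\,\omega^{2l+\delta}$ ($\varepsilon=0,1$), where $$\tau(x_0+\mathbf ix_1+\mathbf jx_2+\mathbf kx_3)=\begin{pmatrix}x_0-ix_1&-x_2+ix_3\\x_2+ix_3&x_0+ix_1\end{pmatrix}.$$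 $SP^{2k}\mathbb C^{2n}$, the cone of *strongly positive* elements, consists of the finite combinations with non-negative coefficients of elements $\eta_1^*\tilde\omega^0\wedge\eta_1^*\tilde\omega^1\wedge\dots\wedge\eta_k^*\tilde\omega^0\wedge\eta_k^*\tilde\omega^1$ with $\eta_1,\dots,\eta_k$ linearly independent right $\mathbb H$-linear maps. A $2k$-form is strongly positive if its value at each point of $\Omega$ is; a $2k$-current $T$ is *positive* if $T(\eta)\ge0$ for all $\eta\in C_0^\infty(\Omega,SP^{2n-2k}\mathbb C^{2n})$. **Proposition.** (a) Let $u$ be PSH on $\Omega$ and not identically $-\infty$ on any connected component of $\Omega$. Then $u$ is finite almost everywhere and locally integrable on $\Omega$, so that it defines a $0$-current, and the $2$-current $\triangle u$, $(\triangle u)(\eta)=\int_\Omega u\,\triangle\eta$, is closed and positive. (b) If $u$ is a real valued PSH function of class $C^2$ on $\Omega$, then $\triangle u$ is a closed strongly positive $2$-form: $\triangle u(q)\in SP^2\mathbb C^{2n}$ for every $q\in\Omega$, the $2$-current $\triangle u$ of (a) is the one defined by the continuous $2$-form $\triangle u$, and this current is closed. If $u$ is moreover of class $C^3$, then $d_0\triangle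 u=d_1\triangle u=0$ pointwise on $\Omega$. -/

import Mathlib

open MeasureTheory TopologicalSpace
open scoped Quaternion Distributions ENNReal

noncomputable section

namespace QPot

/-! ### The space `ℍⁿ` and Lebesgue measure -/

/-- The quaternions carry their Borel σ-algebra. -/
instance instMeasurableSpaceQuaternion : MeasurableSpace ℍ[ℝ] := borel ℍ[ℝ]

instance instBorelSpaceQuaternion : BorelSpace ℍ[ℝ] := ⟨rfl⟩

/-- Lebesgue measure on `ℍ ≅ ℝ⁴`; on `ℍⁿ = Fin n → ℍ` the product measure `dV` is then Lebesgue
measure on `ℝ⁴ⁿ`. -/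
instance instMeasureSpaceQuaternion : MeasureSpace ℍ[ℝ] := measureSpaceOfInnerProductSpace

/-- `ℍⁿ`. Its (product) topology and its differentiable structure are those of `ℝ⁴ⁿ`. -/
abbrev HSpace (n : ℕ) : Type := Fin n → ℍ[ℝ]

/-! ### Plurisubharmonic functions -/

/-- The integral `∫ f⁺ dμ - ∫ f⁻ dμ ∈ [-∞, ∞]` of an extended real valued function. (For an upper
semicontinuous `f < +∞` on a compact space and finite `μ`, the first term is finite.) -/
def extIntegral {X : Type*} [MeasurableSpace X] (μ : Measure X) (f : X → EReal) : EReal :=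
  ((∫⁻ x, (f x).toENNReal ∂μ : ℝ≥0∞) : EReal) - ((∫⁻ x, (-f x).toENNReal ∂μ : ℝ≥0∞) : EReal)

/-- The normalized surface measure on the unit sphere of `ℍ ≅ ℝ⁴`. -/
def sphereProb : Measure (Metric.sphere (0 : ℍ[ℝ]) 1) :=
  ((volume : Measure ℍ[ℝ]).toSphere Set.univ)⁻¹ • (volume : Measure ℍ[ℝ]).toSphere

/-- The integral average of `f` over the sphere of centre `x` and radius `r` in `ℍ`. -/
def sphereMean (f : ℍ[ℝ] → EReal) (x : ℍ[ℝ]) (r : ℝ) : EReal :=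
  extIntegral sphereProb fun ξ => f (x + r • (ξ : ℍ[ℝ]))

/-- `f` is subharmonic on the open set `D ⊆ ℍ ≅ ℝ⁴`: it is upper semicontinuous with values in
`[-∞, ∞)` and satisfies the sub-mean value inequality on every closed ball contained in `D`.
The value `-∞` is allowed, also identically. -/
structure IsSubharmonicOn (D : Set ℍ[ℝ]) (f : ℍ[ℝ] → EReal) : Prop where
  usc : UpperSemicontinuousOn f D
  lt_top : ∀ x ∈ D, f x < ⊤
  le_mean : ∀ (x : ℍ[ℝ]) (r : ℝ), 0 < r → Metric.closedBall x r ⊆ D → f x ≤ sphereMean f x r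

/-- The parametrization `λ ↦ a + v λ` of the right quaternionic line through `a` in direction
`v`. -/
def rightLine {n : ℕ} (a v : HSpace n) (t : ℍ[ℝ]) : HSpace n := fun l => a l + v l * t

/-- `u` is plurisubharmonic on `Ω ⊆ ℍⁿ`: it is upper semicontinuous with values in `[-∞, ∞)` and
subharmonic on (the part in `Ω` of) each right quaternionic line. -/
structure IsPSH {n : ℕ} (Ω : Opens (HSpace n)) (u : HSpace n → EReal) : Prop where
  usc : UpperSemicontinuousOn u Ω
  lt_top : ∀ q ∈ Ω, u q < ⊤
  subharmonic : ∀ a v : HSpace n, v ≠ 0 →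
    IsSubharmonicOn {t | rightLine a v t ∈ Ω} fun t => u (rightLine a v t)

/-! ### The exterior algebra of `ℂ²ⁿ` -/

/-- `ℂ²ⁿ`, with its standard basis as the basis `ω⁰, …, ω²ⁿ⁻¹`. -/
abbrev CSpace (n : ℕ) : Type := Fin (2 * n) → ℂ

/-- The full exterior algebra `∧ ℂ²ⁿ`; its product is the wedge product. -/
abbrev Ext (n : ℕ) : Type := ExteriorAlgebra ℂ (CSpace n)

/-- `∧ᵖ ℂ²ⁿ`, as a complex vector space of its own. -/
def ExtPow (n p : ℕ) : Type := ↥(⋀[ℂ]^p (CSpace n))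

instance instAddCommGroupExtPow (n p : ℕ) : AddCommGroup (ExtPow n p) :=
  inferInstanceAs (AddCommGroup ↥(⋀[ℂ]^p (CSpace n)))

instance instModuleExtPow (n p : ℕ) : Module ℂ (ExtPow n p) :=
  inferInstanceAs (Module ℂ ↥(⋀[ℂ]^p (CSpace n)))

instance instFiniteExtPow (n p : ℕ) : Module.Finite ℂ (ExtPow n p) :=
  inferInstanceAs (Module.Finite ℂ ↥(⋀[ℂ]^p (CSpace n)))

/-- The inclusion `∧ᵖ ℂ²ⁿ ⊆ ∧ ℂ²ⁿ`. -/
def toExt {n p : ℕ} : ExtPow n p →ₗ[ℂ] Ext n := (⋀[ℂ]^p (CSpace n)).subtype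

/-- `ωʲ` as an element of the exterior algebra. -/
def omega {n : ℕ} (j : Fin (2 * n)) : Ext n := ExteriorAlgebra.ι ℂ (Pi.single j 1)

/-- The coefficients `f_I` of an element `∑_I f_I ω^I` of `∧ᵖ ℂ²ⁿ`, the sum being over increasing
multi-indices `I`. -/
def coeffs (n p : ℕ) :
    ExtPow n p ≃ₗ[ℂ] (Set.powersetCard (Fin (2 * n)) p → ℂ) :=
  ((Pi.basisFun ℂ (Fin (2 * n))).exteriorPower p).equivFun

/-- The norm `max_I |f_I|`. It only serves to speak of smooth functions with values in the
finite dimensional space `∧ᵖ ℂ²ⁿ`, where all norms are equivalent. -/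
instance instNormedAddCommGroupExtPow (n p : ℕ) : NormedAddCommGroup (ExtPow n p) :=
  NormedAddCommGroup.induced _ _ (coeffs n p) (coeffs n p).injective

instance instNormedSpaceExtPow (n p : ℕ) : NormedSpace ℂ (ExtPow n p) :=
  NormedSpace.induced ℂ _ _ (coeffs n p)

/-- The coefficient of `Ω₂ₙ = ω⁰ ∧ ω¹ ∧ ⋯ ∧ ω²ⁿ⁻¹`: the linear form on `∧ ℂ²ⁿ` that vanishes on
`∧ᵖ ℂ²ⁿ` for `p ≠ 2n` and sends `v₀ ∧ ⋯ ∧ v₂ₙ₋₁` to `det (v₀, …, v₂ₙ₋₁)`. -/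
def topCoeff (n : ℕ) : Ext n →ₗ[ℂ] ℂ :=
  ExteriorAlgebra.liftAlternating
    (Pi.single (2 * n) (Matrix.detRowAlternating (n := Fin (2 * n)) (R := ℂ)))

theorem omega_mul_mem {n k m : ℕ} (h : k + 1 = m) (j : Fin (2 * n)) (x : ExtPow n k) :
    omega j * toExt x ∈ ⋀[ℂ]^m (CSpace n) := by
  subst h
  have h1 := Submodule.mul_mem_mul (LinearMap.mem_range_self (ExteriorAlgebra.ι ℂ)
    (Pi.single j 1 : CSpace n)) x.2
  have h2 := pow_succ' (LinearMap.range (ExteriorAlgebra.ι ℂ (M := CSpace n))) k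
  rw [← h2] at h1
  exact h1

/-- `x ↦ ωʲ ∧ x` from `∧ᵏ ℂ²ⁿ` to `∧ᵏ⁺¹ ℂ²ⁿ`. -/
def wedgeLeft {n k m : ℕ} (h : k + 1 = m) (j : Fin (2 * n)) : ExtPow n k →L[ℂ] ExtPow n m :=
  LinearMap.toContinuousLinearMap
    { toFun := fun x => ⟨omega j * toExt x, omega_mul_mem h j x⟩
      map_add' := fun _ _ => Subtype.ext (mul_add _ _ _)
      map_smul' := fun c _ => Subtype.ext (mul_smul_comm c _ _) }

/-! ### Strongly positive elements -/

/-- The `(ε, δ)` entry of the `2 × 2` complex matrix `τ(a)` of a quaternion `a`, `ε, δ ∈ {0, 1}`. -/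
def tau (a : ℍ[ℝ]) (ε δ : Fin 2) : ℂ :=
  !![(a.re : ℂ) - Complex.I * a.imI, -(a.imJ : ℂ) + Complex.I * a.imK;
     (a.imJ : ℂ) + Complex.I * a.imK, (a.re : ℂ) + Complex.I * a.imI] ε δ

/-- For `j = 2l + ε` with `ε ∈ {0, 1}`, the index `l`. -/
def blk {n : ℕ} (j : Fin (2 * n)) : Fin n := ⟨(j : ℕ) / 2, by have := j.2; omega⟩

/-- For `j = 2l + ε` with `ε ∈ {0, 1}`, the index `ε`. -/
def par {n : ℕ} (j : Fin (2 * n)) : Fin 2 := ⟨(j : ℕ) % 2, Nat.mod_lt _ two_pos⟩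

/-- Right `ℍ`-linear maps `ℍⁿ → ℍ`; a left `ℍ`-module. -/
abbrev RightLin (n : ℕ) : Type := HSpace n →ₗ[ℍ[ℝ]ᵐᵒᵖ] ℍ[ℝ]

/-- `η^* ω̃^ε = ∑_j τ(η)_{ε j} ωʲ`, where `τ(η) = (τ(η₀), …, τ(ηₙ₋₁))` is the complex
`2 × 2n` matrix of `η = (η₀, …, ηₙ₋₁)`, `η_l = η(e_l)`, and `ω̃⁰, ω̃¹` is the standard basis of
`ℂ²`. -/
def pullback {n : ℕ} (η : RightLin n) (ε : Fin 2) : Ext n :=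
  ExteriorAlgebra.ι ℂ fun j : Fin (2 * n) => tau (η (Pi.single (blk j) 1)) ε (par j)

/-- `x = η₁^*ω̃⁰ ∧ η₁^*ω̃¹ ∧ ⋯ ∧ η_k^*ω̃⁰ ∧ η_k^*ω̃¹` for some (left `ℍ`-) linearly independent
right `ℍ`-linear maps `η₁, …, η_k : ℍⁿ → ℍ`. -/
def IsElementaryStronglyPositive {n : ℕ} (k : ℕ) (x : Ext n) : Prop :=
  ∃ η : Fin k → RightLin n, LinearIndependent ℍ[ℝ] η ∧
    x = (List.ofFn fun i => pullback (η i) 0 * pullback (η i) 1).prod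

/-- The convex cone `SP²ᵏ ℂ²ⁿ`: finite combinations of elementary strongly positive elements with
non-negative real coefficients. -/
def IsStronglyPositive {n : ℕ} (k : ℕ) (x : Ext n) : Prop :=
  ∃ (m : ℕ) (c : Fin m → ℝ) (ξ : Fin m → Ext n), (∀ i, 0 ≤ c i) ∧
    (∀ i, IsElementaryStronglyPositive k (ξ i)) ∧ x = ∑ i, (c i : ℂ) • ξ i

/-! ### The operators `∇_{jα}`, `d₀`, `d₁` and the Baston operator on forms -/

/-- The quaternion `𝐢`. -/
def unitI : ℍ[ℝ] := ⟨0, 1, 0, 0⟩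

/-- The quaternion `𝐣`. -/
def unitJ : ℍ[ℝ] := ⟨0, 0, 1, 0⟩

/-- The quaternion `𝐤 = 𝐢𝐣`. -/
def unitK : ℍ[ℝ] := ⟨0, 0, 0, 1⟩

/-- The first-order operators `∇_{jα}`, `j = 2l + ε`, have the form `∂_a + i ∂_b`, with real
directions `a`, `b` in the `l`-th factor of `ℍⁿ`. This is the pair `(a, b)`:
`∇_{(2l)0} = ∂_{x_{4l}} + i ∂_{x_{4l+1}}`, `∇_{(2l)1} = -∂_{x_{4l+2}} - i ∂_{x_{4l+3}}`,
`∇_{(2l+1)0} = ∂_{x_{4l+2}} - i ∂_{x_{4l+3}}`, `∇_{(2l+1)1} = ∂_{x_{4l}} - i ∂_{x_{4l+1}}`,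
where `q_l = x_{4l} + 𝐢 x_{4l+1} + 𝐣 x_{4l+2} + 𝐤 x_{4l+3}`. -/
def nablaDir (ε α : Fin 2) : ℍ[ℝ] × ℍ[ℝ] :=
  !![(1, unitI), (-unitJ, -unitK); (unitJ, -unitK), (1, -unitI)] ε α

/-- The direction `a` of `∇_{jα} = ∂_a + i ∂_b`. -/
def dirRe {n : ℕ} (j : Fin (2 * n)) (α : Fin 2) : HSpace n :=
  Pi.single (blk j) (nablaDir (par j) α).1

/-- The direction `b` of `∇_{jα} = ∂_a + i ∂_b`. -/
def dirIm {n : ℕ} (j : Fin (2 * n)) (α : Fin 2) : HSpace n :=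
  Pi.single (blk j) (nablaDir (par j) α).2

/-- `∇_{jα} F` for a function `F` on (an open subset of) `ℍⁿ`. -/
def nabla {n : ℕ} {W : Type*} [NormedAddCommGroup W] [NormedSpace ℂ W] (j : Fin (2 * n))
    (α : Fin 2) (F : HSpace n → W) (q : HSpace n) : W :=
  fderiv ℝ F q (dirRe j α) + Complex.I • fderiv ℝ F q (dirIm j α)

/-- `d_α F = ∑_j ωʲ ∧ ∇_{jα} F` for a form `F`. -/
def dForm {n k m : ℕ} (α : Fin 2) (h : k + 1 = m) (F : HSpace n → ExtPow n k) :
    HSpace n → ExtPow n m :=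
  fun q => ∑ j, wedgeLeft h j (nabla j α F q)

/-- `1 ∈ ∧⁰ ℂ²ⁿ = ℂ`. -/
def oneForm (n : ℕ) : ExtPow n 0 :=
  ⟨1, (pow_zero (LinearMap.range (ExteriorAlgebra.ι ℂ (M := CSpace n)))).ge
    (Submodule.one_le.mp le_rfl)⟩

/-- A complex valued function as a `0`-form. -/
def scalarForm {n : ℕ} (f : HSpace n → ℂ) : HSpace n → ExtPow n 0 :=
  fun q => f q • oneForm n

/-- The Baston operator `△ v = d₀ d₁ v` on functions. -/
def bastonForm {n : ℕ} (v : HSpace n → ℝ) : HSpace n → ExtPow n 2 :=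
  dForm 0 rfl (dForm 1 rfl (scalarForm fun q => (v q : ℂ)))

/-! ### Test forms and currents -/

/-- The space `𝒟ᵖ(Ω) = C₀^∞(Ω, ∧ᵖ ℂ²ⁿ)` of test `p`-forms, with its usual LF topology. -/
abbrev TestForm {n : ℕ} (Ω : Opens (HSpace n)) (p : ℕ) : Type := 𝓓(Ω, ExtPow n p)

/-- `d_α : 𝒟ᵏ(Ω) → 𝒟ᵏ⁺¹(Ω)`, `d_α η = ∑_j ωʲ ∧ ∇_{jα} η`. -/
def dTest {n k m : ℕ} {Ω : Opens (HSpace n)} (α : Fin 2) (h : k + 1 = m) :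
    TestForm Ω k →L[ℂ] TestForm Ω m :=
  ∑ j, (TestFunction.postcompCLM (wedgeLeft h j) ∘L TestFunction.lineDerivCLM ℂ (dirRe j α) +
    TestFunction.postcompCLM (Complex.I • wedgeLeft h j) ∘L
      TestFunction.lineDerivCLM ℂ (dirIm j α))

/-- On test forms, `dTest` is the operator `dForm`. -/
theorem dTest_apply {n k m : ℕ} {Ω : Opens (HSpace n)} (α : Fin 2) (h : k + 1 = m)
    (η : TestForm Ω k) (q : HSpace n) : dTest α h η q = dForm α h η q := by
  have hd : DifferentiableAt ℝ η q := (η.contDiff.differentiable (by simp)).differentiableAt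
  simp [dTest, dForm, nabla, hd.lineDeriv_eq_fderiv, TestFunction.lineDerivCLM_apply]

/-- `p`-currents on `Ω`: the elements of the dual space of `𝒟²ⁿ⁻ᵖ(Ω)`. (Used for `p ≤ 2n`.) -/
abbrev Current {n : ℕ} (Ω : Opens (HSpace n)) (p : ℕ) : Type :=
  TestForm Ω (2 * n - p) →L[ℂ] ℂ

/-- `(d_α T)(η) = -T(d_α η)`. -/
def dCurrent {n p : ℕ} {Ω : Opens (HSpace n)} (α : Fin 2) (h : p + 1 ≤ 2 * n)
    (T : Current Ω p) : Current Ω (p + 1) :=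
  -(T ∘L dTest α (by omega))

/-- `(△ T)(η) = T(△ η) = T(d₀ d₁ η)`. -/
def bastonCurrent {n p : ℕ} {Ω : Opens (HSpace n)} (h : p + 2 ≤ 2 * n)
    (T : Current Ω p) : Current Ω (p + 2) :=
  T ∘L dTest 0 (show (2 * n - (p + 2) + 1) + 1 = 2 * n - p by omega) ∘L dTest 1 rfl

/-- A current is closed if `d₀ T = d₁ T = 0`. (For `p ≥ 2n` there is nothing to require, as
there are no `(p+1)`-currents.) -/
def IsClosedCurrent {n p : ℕ} {Ω : Opens (HSpace n)} (T : Current Ω p) : Prop :=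
  ∀ (α : Fin 2) (h : p + 1 ≤ 2 * n), dCurrent α h T = 0

/-- A `2k`-current is positive if `T(η) ≥ 0` for each `η ∈ C₀^∞(Ω, SP²ⁿ⁻²ᵏ ℂ²ⁿ)`. -/
def IsPositiveCurrent {n : ℕ} (k : ℕ) {Ω : Opens (HSpace n)} (T : Current Ω (2 * k)) : Prop :=
  ∀ η : TestForm Ω (2 * n - 2 * k), (∀ q, IsStronglyPositive (n - k) (toExt (η q))) →
    0 ≤ (T η).re ∧ (T η).im = 0

/-- `T` is the current `T_ψ` associated with a locally integrable `p`-form `ψ` on `Ω`: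
`T(φ) = ∫_Ω ψ ∧ φ`, where `∫_Ω f Ω₂ₙ = ∫_Ω f dV`. -/
def IsCurrentOf {n p : ℕ} {Ω : Opens (HSpace n)} (T : Current Ω p)
    (ψ : HSpace n → ExtPow n p) : Prop :=
  LocallyIntegrableOn ψ (Ω : Set (HSpace n)) ∧
    ∀ φ : TestForm Ω (2 * n - p),
      T φ = ∫ q in (Ω : Set (HSpace n)), topCoeff n (toExt (ψ q) * toExt (φ q))

end QPot

end

open QPot

/-!
Averaging the sub-mean value inequality on right quaternionic lines over right multiplication by
unit quaternions gives a sub-mean value inequality over balls of `ℍⁿ`. Hence the set of points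
near which `u` is integrable is open and closed, and an upper semicontinuous `u` that is finite
somewhere on a component is locally integrable there.

For `g` of class `C²`, a second order Taylor expansion turns the inequality on the line through
`q` in the direction `v` into `∑_{e ∈ {1, 𝐢, 𝐣, 𝐤}} D²g(q)(ve, ve) ≥ 0`. The form `△g(q)` is a
linear function of the Hessian which is invariant under right multiplication by `1, 𝐢, 𝐣, 𝐤`, so
it only depends on the average of the Hessian over these, a positive semidefinite form.
Diagonalising the average over `ℝ` writes it as a non-negative combination of squares of real
linear functions. Each of these is the real part of a right `ℍ`-linear `η`, and its square
contributes a positive multiple of `η^*ω̃⁰ ∧ η^*ω̃¹`: thus `△g(q)` is strongly positive. The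
product of strongly positive elements of complementary degrees is a non-negative multiple of
`Ω₂ₙ`, because `det τ(A) ≥ 0` for every quaternionic matrix `A`, by induction on its size through
Schur complements.

A general `u` is a local `L¹` limit of its mollifications, which are smooth and plurisubharmonic,
and for these positivity of the current follows from the smooth case after integration by parts.
Closedness is dual to `d₀² = d₁² = 0` and `d₀d₁ = -d₁d₀`.
-/

noncomputable section

namespace QPot

open Filter Topology Metric
open scoped ComplexOrder

/-! ### Extended integrals of functions bounded above -/

section Gap

variable {X : Type*} {f : X → EReal} {M : ℝ} {x : X}

/-- The function `M - f`, for `f ≤ M`. Being non-negative, it turns integrals of functions with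
values in `[-∞, M]` into lower Lebesgue integrals. -/
def gap (M : ℝ) (f : X → EReal) (x : X) : ℝ≥0∞ :=
  ((M : EReal) - f x).toENNReal

theorem gap_eq_top_iff : gap M f x = ⊤ ↔ f x = ⊥ := by
  unfold gap
  induction f x with
  | bot => simp
  | top => simp
  | coe r => simp [← EReal.coe_sub]

theorem toReal_eq_sub_gap (hM : f x ≤ M) (hbot : f x ≠ ⊥) :
    (f x).toReal = M - (gap M f x).toReal := by
  lift f x to ℝ using ⟨(hM.trans_lt (EReal.coe_lt_top M)).ne, hbot⟩ with r hr
  rw [EReal.coe_le_coe_iff] at hM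
  rw [gap, ← hr, ← EReal.coe_sub, EReal.real_coe_toENNReal, EReal.toReal_coe,
    ENNReal.toReal_ofReal (sub_nonneg.2 hM), sub_sub_cancel]

theorem gap_add_toENNReal (hM₀ : 0 ≤ M) (hM : f x ≤ M) :
    gap M f x + (f x).toENNReal = ENNReal.ofReal M + (-f x).toENNReal := by
  unfold gap
  induction h : f x with
  | bot => simp
  | top => simp [h] at hM
  | coe r =>
    rw [h, EReal.coe_le_coe_iff] at hM
    rw [← EReal.coe_sub, ← EReal.coe_neg]
    simp only [EReal.real_coe_toENNReal]
    rcases le_total 0 r with hr | hr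
    · rw [ENNReal.ofReal_of_nonpos (neg_nonpos.2 hr), add_zero,
        ← ENNReal.ofReal_add (sub_nonneg.2 hM) hr, sub_add_cancel]
    · rw [ENNReal.ofReal_of_nonpos hr, add_zero, ← ENNReal.ofReal_add hM₀ (neg_nonneg.2 hr),
        sub_eq_add_neg]

theorem coe_sub_coe_eq_of_add_eq_add {a b c d : ℝ≥0∞} (h : a + b = c + d) (hb : b ≠ ⊤)
    (hc : c ≠ ⊤) : (b : EReal) - d = c - a := by
  lift b to NNReal using hb
  lift c to NNReal using hc
  obtain rfl | hd := eq_or_ne d ⊤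
  · have ha : a = ⊤ := by simpa using h
    simp [ha]
  · have ha : a ≠ ⊤ := fun ha => hd (by simpa [ha] using h.symm)
    lift d to NNReal using hd
    lift a to NNReal using ha
    have h' : (a : ℝ) + b = c + d := by exact_mod_cast h
    change (((b : ℝ) - d : ℝ) : EReal) = ((c - a : ℝ) : EReal)
    congr 1
    linarith

variable [MeasurableSpace X] {μ : Measure X}

theorem measurable_gap (hf : Measurable f) (M : ℝ) : Measurable (gap M f) :=
  (measurable_const.sub hf).ereal_toENNReal

theorem extIntegral_eq_sub_lintegral_gap [IsProbabilityMeasure μ] (hf : Measurable f)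
    (hM₀ : 0 ≤ M) (hM : ∀ x, f x ≤ M) :
    extIntegral μ f = M - ((∫⁻ x, gap M f x ∂μ : ℝ≥0∞) : EReal) := by
  have hsum : ∫⁻ x, gap M f x ∂μ + ∫⁻ x, (f x).toENNReal ∂μ =
      ENNReal.ofReal M + ∫⁻ x, (-f x).toENNReal ∂μ := by
    rw [← lintegral_add_left (measurable_gap hf M)]
    simp only [gap_add_toENNReal hM₀ (hM _)]
    rw [lintegral_add_left measurable_const, lintegral_const, measure_univ, mul_one]
  have hpos : ∫⁻ x, (f x).toENNReal ∂μ ≤ ENNReal.ofReal M := by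
    calc ∫⁻ x, (f x).toENNReal ∂μ ≤ ∫⁻ _, ENNReal.ofReal M ∂μ :=
          lintegral_mono fun x => by simpa using EReal.toENNReal_le_toENNReal (hM x)
      _ = ENNReal.ofReal M := by simp
  rw [extIntegral, coe_sub_coe_eq_of_add_eq_add hsum (hpos.trans_lt ENNReal.ofReal_lt_top).ne
    ENNReal.ofReal_ne_top, EReal.coe_ennreal_ofReal, max_eq_left hM₀]

theorem lintegral_gap_le_of_le_extIntegral [IsProbabilityMeasure μ] (hf : Measurable f)
    (hM₀ : 0 ≤ M) (hM : ∀ x, f x ≤ M) {c : EReal} (hc : c ≤ extIntegral μ f) :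
    ∫⁻ x, gap M f x ∂μ ≤ ((M : EReal) - c).toENNReal := by
  rw [extIntegral_eq_sub_lintegral_gap hf hM₀ hM,
    EReal.le_sub_iff_add_le (.inr (EReal.coe_ne_bot M)) (.inr (EReal.coe_ne_top M)), add_comm,
    ← EReal.le_sub_iff_add_le (.inr (EReal.coe_ne_bot M)) (.inr (EReal.coe_ne_top M))] at hc
  simpa using EReal.toENNReal_le_toENNReal hc

theorem ae_ne_bot_of_lintegral_gap_ne_top (hf : Measurable f) (h : ∫⁻ x, gap M f x ∂μ ≠ ⊤) :
    ∀ᵐ x ∂μ, f x ≠ ⊥ := by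
  filter_upwards [ae_lt_top (measurable_gap hf M) h] with x hx hx'
  exact hx.ne (gap_eq_top_iff.2 hx')

theorem toReal_ae_eq_sub_gap (hf : Measurable f) (hM : ∀ᵐ x ∂μ, f x ≤ M)
    (h : ∫⁻ x, gap M f x ∂μ ≠ ⊤) :
    (fun x => (f x).toReal) =ᵐ[μ] fun x => M - (gap M f x).toReal := by
  filter_upwards [ae_ne_bot_of_lintegral_gap_ne_top hf h, hM] with x hbot hM
  exact toReal_eq_sub_gap hM hbot

theorem integrable_toReal_of_lintegral_gap_ne_top [IsFiniteMeasure μ] (hf : Measurable f)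
    (hM : ∀ᵐ x ∂μ, f x ≤ M) (h : ∫⁻ x, gap M f x ∂μ ≠ ⊤) :
    Integrable (fun x => (f x).toReal) μ :=
  ((integrable_const M).sub (integrable_toReal_of_lintegral_ne_top
    (measurable_gap hf M).aemeasurable h)).congr (toReal_ae_eq_sub_gap hf hM h).symm

theorem integral_toReal_eq_sub_lintegral_gap [IsFiniteMeasure μ] (hf : Measurable f)
    (hM : ∀ᵐ x ∂μ, f x ≤ M) (h : ∫⁻ x, gap M f x ∂μ ≠ ⊤) :
    ∫ x, (f x).toReal ∂μ = μ.real Set.univ * M - (∫⁻ x, gap M f x ∂μ).toReal := by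
  have hm := (measurable_gap hf M).aemeasurable (μ := μ)
  rw [integral_congr_ae (toReal_ae_eq_sub_gap hf hM h), integral_sub (integrable_const M)
    (integrable_toReal_of_lintegral_ne_top hm h), integral_toReal hm (ae_lt_top' hm h),
    integral_const, smul_eq_mul]

end Gap

/-! ### Right multiplication by quaternions -/

instance instIsAddHaarMeasureQuaternion : (volume : Measure ℍ[ℝ]).IsAddHaarMeasure :=
  inferInstanceAs (measureSpaceOfInnerProductSpace (E := ℍ[ℝ])).volume.IsAddHaarMeasure

instance instIsProbabilityMeasureSphereProb : IsProbabilityMeasure sphereProb where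
  measure_univ := by
    rw [sphereProb, Measure.smul_apply, smul_eq_mul]
    exact ENNReal.inv_mul_cancel (Measure.measure_univ_ne_zero.2 (Measure.toSphere_ne_zero _))
      (measure_ne_top _ _)

/-- Right multiplication by a unit quaternion, as an isometry of `ℍ`. -/
def mulRightIsometry (e : sphere (0 : ℍ[ℝ]) 1) : ℍ[ℝ] ≃ₗᵢ[ℝ] ℍ[ℝ] where
  toFun x := x * e
  invFun x := x * (e : ℍ[ℝ])⁻¹
  map_add' x y := add_mul x y e
  map_smul' c x := smul_mul_assoc c x e
  left_inv x := mul_inv_cancel_right₀ (ne_zero_of_mem_unit_sphere e) x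
  right_inv x := inv_mul_cancel_right₀ (ne_zero_of_mem_unit_sphere e) x
  norm_map' x := (norm_mul x e).trans (by rw [norm_eq_of_mem_sphere, mul_one])

open scoped Pointwise in
theorem measurePreserving_toSphere {E : Type*} [NormedAddCommGroup E] [NormedSpace ℝ E]
    [MeasurableSpace E] [BorelSpace E] {μ : Measure E} {e : E ≃ₗᵢ[ℝ] E}
    (he : MeasurePreserving e μ μ) {g : sphere (0 : E) 1 → sphere (0 : E) 1}
    (hg : ∀ ξ, (g ξ : E) = e ξ) : MeasurePreserving g μ.toSphere μ.toSphere := by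
  have hgm : Measurable g := (continuous_induced_rng.2
    ((e.continuous.comp continuous_subtype_val).congr fun ξ => (hg ξ).symm)).measurable
  refine ⟨hgm, Measure.ext fun s hs => ?_⟩
  have hpre : Set.Ioo (0 : ℝ) 1 • (Subtype.val '' (g ⁻¹' s)) =
      e ⁻¹' (Set.Ioo (0 : ℝ) 1 • (Subtype.val '' s)) := by
    ext x
    simp only [Set.mem_smul, Set.mem_image, Set.mem_preimage, exists_exists_and_eq_and]
    constructor
    · rintro ⟨r, hr, ξ, hξ, rfl⟩
      exact ⟨r, hr, g ξ, hξ, by rw [hg, map_smul]⟩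
    · rintro ⟨r, hr, ζ, hζ, h⟩
      have hmem : e.symm ζ ∈ sphere (0 : E) 1 := by simp
      refine ⟨r, hr, ⟨e.symm ζ, hmem⟩, ?_, ?_⟩
      · rwa [show g ⟨e.symm ζ, hmem⟩ = ζ from Subtype.ext ((hg _).trans (by simp))]
      · rw [← map_smul, h, e.symm_apply_apply]
  rw [Measure.map_apply hgm hs, Measure.toSphere_apply' _ (hgm hs), Measure.toSphere_apply' _ hs,
    hpre, he.measure_preimage_emb e.toHomeomorph.measurableEmbedding]

theorem measurePreserving_sphereProb_mul_right (e : sphere (0 : ℍ[ℝ]) 1) :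
    MeasurePreserving (fun ξ : sphere (0 : ℍ[ℝ]) 1 => ξ * e) sphereProb sphereProb :=
  (measurePreserving_toSphere (mulRightIsometry e).measurePreserving fun _ => rfl).smul_measure _

section RightMultiplication

variable {n : ℕ}

theorem norm_mul_right_le (v : HSpace n) (t : ℍ[ℝ]) :
    ‖(fun l => v l * t : HSpace n)‖ ≤ ‖v‖ * ‖t‖ := by
  refine (pi_norm_le_iff_of_nonneg (by positivity)).2 fun l => ?_
  rw [norm_mul]
  gcongr
  exact norm_le_pi_norm v l

/-- `rmul v t = v t`, the right multiplication of `v ∈ ℍⁿ` by the quaternion `t`, as a continuous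
real bilinear map. -/
def rmul : HSpace n →L[ℝ] ℍ[ℝ] →L[ℝ] HSpace n :=
  LinearMap.mkContinuous₂
    (LinearMap.mk₂ ℝ (fun v t l => v l * t) (fun v w t => funext fun l => add_mul (v l) (w l) t)
      (fun c v t => funext fun l => smul_mul_assoc c (v l) t)
      (fun v s t => funext fun l => mul_add (v l) s t)
      (fun c v t => funext fun l => mul_smul_comm c (v l) t)) 1
    fun v t => (norm_mul_right_le v t).trans_eq (by rw [one_mul])

theorem rightLine_eq (a v : HSpace n) (t : ℍ[ℝ]) : rightLine a v t = a + rmul v t := rfl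

theorem rmul_one (v : HSpace n) : rmul v 1 = v := funext fun l => mul_one (v l)

theorem rmul_rmul (v : HSpace n) (s t : ℍ[ℝ]) : rmul (rmul v s) t = rmul v (s * t) :=
  funext fun l => mul_assoc (v l) s t

theorem norm_rmul_le (v : HSpace n) (t : ℍ[ℝ]) : ‖rmul v t‖ ≤ ‖v‖ * ‖t‖ :=
  norm_mul_right_le v t

theorem norm_rmul_sphere (v : HSpace n) (ξ : sphere (0 : ℍ[ℝ]) 1) : ‖rmul v ξ‖ = ‖v‖ := by
  refine le_antisymm (by simpa using norm_rmul_le v ξ) ?_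
  simpa [rmul_rmul, rmul_one, mul_inv_cancel₀ (ne_zero_of_mem_unit_sphere ξ)] using
    norm_rmul_le (rmul v ξ) (ξ : ℍ[ℝ])⁻¹

theorem measurePreserving_rmul (ξ : sphere (0 : ℍ[ℝ]) 1) :
    MeasurePreserving (fun v : HSpace n => rmul v ξ) volume volume :=
  volume_preserving_pi fun _ => (mulRightIsometry ξ).measurePreserving

theorem add_rmul_mem_ball {a v : HSpace n} {r : ℝ} (hv : ‖v‖ < r) {t : ℍ[ℝ]} (ht : ‖t‖ ≤ 1) :
    a + rmul v t ∈ ball a r := by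
  rw [mem_ball_iff_norm, add_sub_cancel_left]
  exact ((norm_rmul_le v t).trans (mul_le_of_le_one_right (norm_nonneg v) ht)).trans_lt hv

end RightMultiplication

/-! ### Local integrability of plurisubharmonic functions -/

theorem IsSubharmonicOn.congr {D : Set ℍ[ℝ]} {f g : ℍ[ℝ] → EReal} (hf : IsSubharmonicOn D f)
    (h : Set.EqOn f g D) : IsSubharmonicOn D g where
  usc x hx c hc := by
    filter_upwards [hf.usc x hx c (by simpa only [h hx] using hc), self_mem_nhdsWithin]
      with y hy hyD
    rwa [← h hyD]
  lt_top x hx := h hx ▸ hf.lt_top x hx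
  le_mean x r hr hD := by
    have hsphere : ∀ ξ : sphere (0 : ℍ[ℝ]) 1, f (x + r • (ξ : ℍ[ℝ])) = g (x + r • (ξ : ℍ[ℝ])) :=
      fun ξ => h (hD (by simp [norm_smul, abs_of_pos hr]))
    simpa only [sphereMean, hsphere, h (hD (mem_closedBall_self hr.le))] using hf.le_mean x r hr hD

namespace IsPSH

variable {n : ℕ} {Ω : Opens (HSpace n)} {u w : HSpace n → EReal}

theorem congr (hu : IsPSH Ω u) (h : Set.EqOn u w Ω) : IsPSH Ω w where
  usc q hq c hc := by
    filter_upwards [hu.usc q hq c (by simpa only [h hq] using hc), self_mem_nhdsWithin]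
      with x hx hxΩ
    rwa [← h hxΩ]
  lt_top q hq := h hq ▸ hu.lt_top q hq
  subharmonic a v hv := (hu.subharmonic a v hv).congr fun _ ht => h ht

open scoped Classical in
theorem exists_measurable_eqOn (hu : IsPSH Ω u) :
    ∃ w, Measurable w ∧ Set.EqOn u w Ω ∧ IsPSH Ω w := by
  have heq : Set.EqOn u ((Ω : Set (HSpace n)).piecewise u fun _ => ⊥) Ω :=
    (Set.piecewise_eqOn _ _ _).symm
  refine ⟨_, measurable_of_Iio fun c => ?_, heq, hu.congr heq⟩
  have hopen : IsOpen (Ω ∩ u ⁻¹' Set.Iio c : Set (HSpace n)) := by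
    obtain ⟨V, hV, hVeq⟩ := upperSemicontinuousOn_iff_preimage_Iio.1 hu.usc c
    rw [hVeq]
    exact Ω.isOpen.inter hV
  rw [Set.piecewise_preimage, Set.ite, Set.inter_comm]
  exact hopen.measurableSet.union
    ((measurable_const measurableSet_Iio).diff Ω.isOpen.measurableSet)

theorem exists_forall_le_of_isCompact (hu : IsPSH Ω u) {K : Set (HSpace n)} (hK : IsCompact K)
    (hKΩ : K ⊆ Ω) : ∃ M : ℝ, 0 ≤ M ∧ ∀ q ∈ K, u q ≤ M := by
  obtain rfl | hne := K.eq_empty_or_nonempty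
  · exact ⟨0, le_rfl, by simp⟩
  obtain ⟨q, hq, hmax⟩ := (hu.usc.mono hKΩ).exists_isMaxOn hne hK
  refine ⟨max (u q).toReal 0, le_max_right _ _, fun x hx => (hmax hx).trans ?_⟩
  exact (EReal.le_coe_toReal (hu.lt_top q (hKΩ hq)).ne).trans
    (EReal.coe_le_coe_iff.2 (le_max_left _ _))

theorem lintegral_gap_sphere_le (hu : IsPSH Ω u) (hm : Measurable u) {a v : HSpace n} {M : ℝ}
    (hM₀ : 0 ≤ M) (hΩ : ∀ t : ℍ[ℝ], ‖t‖ ≤ 1 → a + rmul v t ∈ Ω)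
    (hM : ∀ t : ℍ[ℝ], ‖t‖ ≤ 1 → u (a + rmul v t) ≤ M) :
    ∫⁻ ξ, gap M u (a + rmul v ξ) ∂sphereProb ≤ gap M u a := by
  obtain rfl | hv := eq_or_ne v 0
  · simp
  have hmean := (hu.subharmonic a v hv).le_mean 0 1 one_pos fun t ht => hΩ t (by simpa using ht)
  simp only [sphereMean, rightLine_eq, map_zero, add_zero, zero_add, one_smul] at hmean
  have hline : Measurable fun ξ : sphere (0 : ℍ[ℝ]) 1 => a + rmul v ξ :=
    (by fun_prop : Continuous fun ξ : sphere (0 : ℍ[ℝ]) 1 => a + rmul v ξ).measurable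
  exact lintegral_gap_le_of_le_extIntegral (hm.comp hline) hM₀
    (fun ξ => hM ξ (norm_eq_of_mem_sphere ξ).le) hmean

end IsPSH

theorem setLIntegral_ball_add_rmul {n : ℕ} {g : HSpace n → ℝ≥0∞} (hg : Measurable g)
    (a : HSpace n) (r : ℝ) (ξ : sphere (0 : ℍ[ℝ]) 1) :
    ∫⁻ v in ball 0 r, g (a + rmul v ξ) = ∫⁻ q in ball a r, g q := by
  have hmp : MeasurePreserving (fun v : HSpace n => a + rmul v ξ) volume volume :=
    (measurePreserving_add_left volume a).comp (measurePreserving_rmul ξ)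
  rw [← hmp.setLIntegral_comp_preimage measurableSet_ball hg]
  congr 2
  ext v
  simp [norm_rmul_sphere]

theorem setLIntegral_ball_eq_lintegral_sphere {n : ℕ} {g : HSpace n → ℝ≥0∞} (hg : Measurable g)
    (a : HSpace n) (r : ℝ) :
    ∫⁻ q in ball a r, g q = ∫⁻ v in ball 0 r, ∫⁻ ξ, g (a + rmul v ξ) ∂sphereProb := by
  have hcont : Continuous fun p : sphere (0 : ℍ[ℝ]) 1 × HSpace n => a + rmul p.2 p.1 := by fun_prop
  rw [← lintegral_lintegral_swap (f := fun (ξ : sphere (0 : ℍ[ℝ]) 1) v => g (a + rmul v ξ))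
    (hg.comp hcont.measurable).aemeasurable]
  simp [setLIntegral_ball_add_rmul hg]

/-- The set of points near which `u` is finite almost everywhere and integrable. -/
def integrableLocus {X : Type*} [TopologicalSpace X] [MeasureSpace X] (u : X → EReal) : Set X :=
  {x | ∃ s ∈ 𝓝 x, (∀ᵐ q ∂volume.restrict s, u q ≠ ⊥) ∧ IntegrableOn (fun q => (u q).toReal) s}

section IntegrableLocus

variable {X : Type*} [TopologicalSpace X] [MeasureSpace X] {u : X → EReal}

theorem isOpen_integrableLocus : IsOpen (integrableLocus u) := by
  refine isOpen_iff_mem_nhds.2 fun x ⟨s, hs, hu⟩ => ?_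
  filter_upwards [eventually_mem_nhds_iff.2 hs] with y hy
  exact ⟨s, hy, hu⟩

theorem exists_mem_ne_bot_of_mem_closure_integrableLocus [OpensMeasurableSpace X]
    [(volume : Measure X).IsOpenPosMeasure] {x : X} (hx : x ∈ closure (integrableLocus u))
    {U : Set X} (hU : U ∈ 𝓝 x) : ∃ z ∈ U, u z ≠ ⊥ := by
  obtain ⟨y, hyU, s, hs, hfin, -⟩ := mem_closure_iff_nhds.1 hx _ (interior_mem_nhds.2 hU)
  have hopen : IsOpen (interior (s ∩ U)) := isOpen_interior
  have hy : y ∈ interior (s ∩ U) := by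
    rw [interior_inter]
    exact ⟨mem_interior_iff_mem_nhds.2 hs, hyU⟩
  have : (ae (volume.restrict (interior (s ∩ U)))).NeBot :=
    ae_neBot.2 (Measure.restrict_eq_zero.not.2 (hopen.measure_pos _ ⟨y, hy⟩).ne')
  have hfin' := ae_restrict_of_ae_restrict_of_subset
    (interior_subset.trans (Set.inter_subset_left (t := U))) hfin
  obtain ⟨z, hz, hzmem⟩ := (hfin'.and (ae_restrict_mem hopen.measurableSet)).exists
  exact ⟨z, (interior_subset hzmem).2, hz⟩

theorem locallyIntegrableOn_toReal_of_subset_integrableLocus {s : Set X}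
    (h : s ⊆ integrableLocus u) : LocallyIntegrableOn (fun q => (u q).toReal) s := fun _ hx =>
  let ⟨t, ht, _, hint⟩ := h hx
  ⟨t, mem_nhdsWithin_of_mem_nhds ht, hint⟩

theorem ae_restrict_ne_bot_of_subset_integrableLocus [SecondCountableTopology X] {s : Set X}
    (h : s ⊆ integrableLocus u) : ∀ᵐ q ∂volume.restrict s, u q ≠ ⊥ := by
  choose! t ht hfin _ using h
  obtain ⟨c, hcs, hc, hsc⟩ := countable_cover_nhdsWithin fun x hx =>
    mem_nhdsWithin_of_mem_nhds (ht hx)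
  exact ae_restrict_of_ae_restrict_of_subset hsc
    ((ae_restrict_biUnion_iff t hc _).2 fun x hx => hfin (hcs hx))

end IntegrableLocus

namespace IsPSH

variable {n : ℕ} {Ω : Opens (HSpace n)} {u : HSpace n → EReal}

theorem setLIntegral_gap_ball_le (hu : IsPSH Ω u) (hm : Measurable u) {a : HSpace n} {r M : ℝ}
    (hM₀ : 0 ≤ M) (hΩ : ball a r ⊆ Ω) (hM : ∀ q ∈ ball a r, u q ≤ M) :
    ∫⁻ q in ball a r, gap M u q ≤ gap M u a * volume (ball a r) := by
  calc ∫⁻ q in ball a r, gap M u q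
      = ∫⁻ v in ball 0 r, ∫⁻ ξ, gap M u (a + rmul v ξ) ∂sphereProb :=
        setLIntegral_ball_eq_lintegral_sphere (measurable_gap hm M) a r
    _ ≤ ∫⁻ _ in ball (0 : HSpace n) r, gap M u a := by
        refine setLIntegral_mono measurable_const fun v hv => ?_
        have hmem : ∀ t : ℍ[ℝ], ‖t‖ ≤ 1 → a + rmul v t ∈ ball a r := fun t =>
          add_rmul_mem_ball (mem_ball_zero_iff.1 hv)
        exact hu.lintegral_gap_sphere_le hm hM₀ (fun t ht => hΩ (hmem t ht))
          fun t ht => hM _ (hmem t ht)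
    _ = gap M u a * volume (ball a r) := by
        rw [setLIntegral_const, Measure.addHaar_ball_center volume a]

theorem ball_subset_integrableLocus (hu : IsPSH Ω u) {a : HSpace n} {r : ℝ}
    (hΩ : closedBall a r ⊆ Ω) (ha : u a ≠ ⊥) : ball a r ⊆ integrableLocus u := by
  intro x hx
  obtain ⟨w, hwm, huw, hw⟩ := hu.exists_measurable_eqOn
  obtain ⟨M, hM₀, hM⟩ := hw.exists_forall_le_of_isCompact (isCompact_closedBall a r) hΩ
  have hball := ball_subset_closedBall.trans hΩ
  have haw : gap M w a < ⊤ := by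
    rwa [lt_top_iff_ne_top, Ne, gap_eq_top_iff, ← huw (hball (mem_ball_self (pos_of_mem_ball hx)))]
  have hgap : ∫⁻ q in ball a r, gap M w q ≠ ⊤ :=
    ((hw.setLIntegral_gap_ball_le hwm hM₀ hball fun q hq =>
      hM q (ball_subset_closedBall hq)).trans_lt (ENNReal.mul_lt_top haw measure_ball_lt_top)).ne
  have : IsFiniteMeasure (volume.restrict (ball a r)) := ⟨by simpa using measure_ball_lt_top⟩
  have hMae : ∀ᵐ q ∂volume.restrict (ball a r), w q ≤ M := by
    filter_upwards [ae_restrict_mem measurableSet_ball] with q hq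
    exact hM q (ball_subset_closedBall hq)
  refine ⟨ball a r, isOpen_ball.mem_nhds hx, ?_, ?_⟩
  · filter_upwards [ae_ne_bot_of_lintegral_gap_ne_top hwm hgap, ae_restrict_mem measurableSet_ball]
      with q hq hqmem
    rwa [huw (hball hqmem)]
  · exact IntegrableOn.congr_fun (integrable_toReal_of_lintegral_gap_ne_top hwm hMae hgap)
      (fun q hq => by rw [huw (hball hq)]) measurableSet_ball

theorem mem_integrableLocus_of_mem_closure (hu : IsPSH Ω u) {x : HSpace n} (hx : x ∈ Ω)
    (hcl : x ∈ closure (integrableLocus u)) : x ∈ integrableLocus u := by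
  obtain ⟨r, hr, hrΩ⟩ := nhds_basis_closedBall.mem_iff.1 (Ω.isOpen.mem_nhds hx)
  obtain ⟨z, hz, hzu⟩ := exists_mem_ne_bot_of_mem_closure_integrableLocus hcl
    (ball_mem_nhds x (half_pos hr))
  refine hu.ball_subset_integrableLocus (r := r / 2) ((closedBall_subset_closedBall' ?_).trans hrΩ)
    hzu (mem_ball_comm.1 hz)
  linarith [mem_ball.1 hz]

theorem subset_integrableLocus (hu : IsPSH Ω u)
    (hne : ∀ a ∈ Ω, ∃ q ∈ connectedComponentIn (Ω : Set (HSpace n)) a, u q ≠ ⊥) :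
    (Ω : Set (HSpace n)) ⊆ integrableLocus u := by
  intro a ha
  suffices connectedComponentIn (Ω : Set (HSpace n)) a ⊆ integrableLocus u from
    this (mem_connectedComponentIn ha)
  obtain ⟨q, hq, hqu⟩ := hne a ha
  have hqΩ : q ∈ Ω := connectedComponentIn_subset _ _ hq
  obtain ⟨r, hr, hrΩ⟩ := nhds_basis_closedBall.mem_iff.1 (Ω.isOpen.mem_nhds hqΩ)
  exact isPreconnected_connectedComponentIn.subset_of_closure_inter_subset isOpen_integrableLocus
    ⟨q, hq, hu.ball_subset_integrableLocus hrΩ hqu (mem_ball_self hr)⟩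
    fun x hx => hu.mem_integrableLocus_of_mem_closure (connectedComponentIn_subset _ _ hx.2) hx.1

end IsPSH

/-! ### The second-order test -/

section Taylor

variable {E F : Type*} [NormedAddCommGroup E] [NormedSpace ℝ E] [NormedAddCommGroup F]
  [NormedSpace ℝ F] {g : E → F} {x y : E}

theorem hasFDerivAt_sub_quadratic {g' : E →L[ℝ] F} (hg : HasFDerivAt g g' y) (x : E)
    (L : E →L[ℝ] F) {B : E →L[ℝ] E →L[ℝ] F} (hB : ∀ v w, B v w = B w v) :
    HasFDerivAt (fun y => g y - g x - L (y - x) - (2⁻¹ : ℝ) • B (y - x) (y - x))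
      (g' - L - B (y - x)) y := by
  have hid : HasFDerivAt (fun y => y - x) (.id ℝ E) y := (hasFDerivAt_id y).sub_const x
  have hquad := (B.hasFDerivAt_of_bilinear hid hid).const_smul (2⁻¹ : ℝ)
  refine (((hg.sub_const (g x)).sub (L.hasFDerivAt.comp y hid)).sub hquad).congr_fderiv ?_
  ext w
  simp only [sub_apply, smul_apply, add_apply, ContinuousLinearMap.comp_id,
    ContinuousLinearMap.precompR_apply, ContinuousLinearMap.compL_apply,
    ContinuousLinearMap.precompL_apply, ContinuousLinearMap.id_apply, hB w]
  rw [← two_smul ℝ, inv_smul_smul₀ two_ne_zero]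

theorem taylor_two_isLittleO (hg : ContDiffAt ℝ 2 g x) :
    (fun y => g y - g x - fderiv ℝ g x (y - x)
        - (2⁻¹ : ℝ) • fderiv ℝ (fderiv ℝ g) x (y - x) (y - x))
      =o[𝓝 x] fun y => ‖y - x‖ ^ 2 := by
  have hdiff : ∀ᶠ y in 𝓝 x, DifferentiableAt ℝ g y := by
    filter_upwards [hg.eventually (by simp)] with y hy using hy.differentiableAt (by simp)
  obtain ⟨δ, hδ, hball⟩ := eventually_nhds_iff_ball.1 hdiff
  have hB : HasFDerivAt (fderiv ℝ g) (fderiv ℝ (fderiv ℝ g) x) x :=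
    ((hg.fderiv_right (m := 1) (by norm_num)).differentiableAt (by simp)).hasFDerivAt
  have hsmall := (convex_ball x δ).isLittleO_pow_succ (mem_ball_self hδ) (n := 1)
    (fun y hy => (hasFDerivAt_sub_quadratic (hball y hy).hasFDerivAt x (fderiv ℝ g x)
      (hg.isSymmSndFDerivAt (by simp))).hasFDerivWithinAt)
    (by simpa [isOpen_ball.nhdsWithin_eq (mem_ball_self hδ)] using hB.isLittleO.norm_right)
  simpa [isOpen_ball.nhdsWithin_eq (mem_ball_self hδ)] using hsmall

end Taylor

theorem eventually_forall_add_smul_mem {E : Type*} [NormedAddCommGroup E] [NormedSpace ℝ E]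
    (T : ℍ[ℝ] →L[ℝ] E) {x : E} {U : Set E} (hU : U ∈ 𝓝 x) :
    ∀ᶠ r : ℝ in 𝓝 0, ∀ t ∈ closedBall (0 : ℍ[ℝ]) 1, x + r • T t ∈ U := by
  refine (isCompact_closedBall 0 1).eventually_forall_of_forall_eventually fun t _ => ?_
  have hcont : Continuous fun z : ℝ × ℍ[ℝ] => x + z.1 • T z.2 := by fun_prop
  exact hcont.tendsto (0, t) (by simpa using hU)

/-- The real basis `1, 𝐢, 𝐣, 𝐤` of `ℍ`. -/
def unitQ : Fin 4 → ℍ[ℝ] := ![1, unitI, unitJ, unitK]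

theorem unitI_components : unitI.re = 0 ∧ unitI.imI = 1 ∧ unitI.imJ = 0 ∧ unitI.imK = 0 :=
  ⟨rfl, rfl, rfl, rfl⟩

theorem unitJ_components : unitJ.re = 0 ∧ unitJ.imI = 0 ∧ unitJ.imJ = 1 ∧ unitJ.imK = 0 :=
  ⟨rfl, rfl, rfl, rfl⟩

theorem unitK_components : unitK.re = 0 ∧ unitK.imI = 0 ∧ unitK.imJ = 0 ∧ unitK.imK = 1 :=
  ⟨rfl, rfl, rfl, rfl⟩

theorem norm_unitQ (e : Fin 4) : ‖unitQ e‖ = 1 := by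
  have h : ‖unitQ e‖ ^ 2 = 1 := by
    rw [sq, ← Quaternion.normSq_eq_norm_mul_self, Quaternion.normSq_def']
    fin_cases e <;> simp [unitQ, unitI, unitJ, unitK]
  exact (pow_eq_one_iff_of_nonneg (norm_nonneg _) two_ne_zero).1 h

theorem quaternion_eq_sum (x : ℍ[ℝ]) :
    x = x.re • (1 : ℍ[ℝ]) + x.imI • unitI + x.imJ • unitJ + x.imK • unitK := by
  ext <;> simp [unitI_components, unitJ_components, unitK_components]

theorem sum_apply_mul_unitQ (C : ℍ[ℝ] →L[ℝ] ℍ[ℝ] →L[ℝ] ℝ) (x : ℍ[ℝ]) :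
    ∑ e, C (x * unitQ e) (x * unitQ e) = ‖x‖ ^ 2 * ∑ e, C (unitQ e) (unitQ e) := by
  have hI : x * unitI =
      (-x.imI) • (1 : ℍ[ℝ]) + x.re • unitI + x.imK • unitJ + (-x.imJ) • unitK := by
    ext <;> simp [unitI_components, unitJ_components, unitK_components]
  have hJ : x * unitJ =
      (-x.imJ) • (1 : ℍ[ℝ]) + (-x.imK) • unitI + x.re • unitJ + x.imI • unitK := by
    ext <;> simp [unitI_components, unitJ_components, unitK_components]
  have hK : x * unitK =
      (-x.imK) • (1 : ℍ[ℝ]) + x.imJ • unitI + (-x.imI) • unitJ + x.re • unitK := by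
    ext <;> simp [unitI_components, unitJ_components, unitK_components]
  simp only [Fin.sum_univ_four, unitQ, Matrix.cons_val, mul_one]
  rw [hI, hJ, hK, sq, ← Quaternion.normSq_eq_norm_mul_self, Quaternion.normSq_def']
  nth_rw 1 2 [quaternion_eq_sum x]
  simp only [map_add, map_smul, add_apply, smul_apply, smul_eq_mul]
  ring

theorem integrable_sphereProb {f : sphere (0 : ℍ[ℝ]) 1 → ℝ} (hf : Continuous f) :
    Integrable f sphereProb :=
  hf.integrable_of_hasCompactSupport (HasCompactSupport.of_compactSpace f)

theorem integral_sphereProb_mul_right (f : ℍ[ℝ] → ℝ) {s : ℍ[ℝ]} (hs : ‖s‖ = 1) :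
    ∫ ξ : sphere (0 : ℍ[ℝ]) 1, f (ξ * s) ∂sphereProb
      = ∫ ξ : sphere (0 : ℍ[ℝ]) 1, f ξ ∂sphereProb :=
  let ζ : sphere (0 : ℍ[ℝ]) 1 := ⟨s, by simp [hs]⟩
  (measurePreserving_sphereProb_mul_right ζ).integral_comp
    (Homeomorph.mulRight ζ).measurableEmbedding (fun ξ => f ξ)

theorem integral_sphereProb_linear (f : ℍ[ℝ] →L[ℝ] ℝ) :
    ∫ ξ : sphere (0 : ℍ[ℝ]) 1, f ξ ∂sphereProb = 0 := by
  have h := integral_sphereProb_mul_right f (s := -1) (by simp)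
  simp only [mul_neg, mul_one, map_neg, integral_neg] at h
  linarith

theorem integral_sphereProb_bilinear (C : ℍ[ℝ] →L[ℝ] ℍ[ℝ] →L[ℝ] ℝ) :
    ∫ ξ : sphere (0 : ℍ[ℝ]) 1, C ξ ξ ∂sphereProb = 4⁻¹ * ∑ e, C (unitQ e) (unitQ e) := by
  have hsum : ∑ e, ∫ ξ : sphere (0 : ℍ[ℝ]) 1, C (ξ * unitQ e) (ξ * unitQ e) ∂sphereProb
      = ∑ e, C (unitQ e) (unitQ e) := by
    rw [← integral_finsetSum _ fun e _ => integrable_sphereProb (by fun_prop)]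
    simp [sum_apply_mul_unitQ]
  simp only [integral_sphereProb_mul_right (fun x => C x x) (norm_unitQ _)] at hsum
  simp [← hsum]

theorem integral_sphereProb_sub_quadratic {φ : sphere (0 : ℍ[ℝ]) 1 → ℝ} (hφ : Continuous φ) (c : ℝ)
    (L : ℍ[ℝ] →L[ℝ] ℝ) (C : ℍ[ℝ] →L[ℝ] ℍ[ℝ] →L[ℝ] ℝ) :
    ∫ ξ, (φ ξ - c - L ξ - C ξ ξ) ∂sphereProb
      = ∫ ξ, φ ξ ∂sphereProb - c - 4⁻¹ * ∑ e, C (unitQ e) (unitQ e) := by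
  rw [integral_sub (integrable_sphereProb (by fun_prop)) (integrable_sphereProb (by fun_prop)),
    integral_sub (integrable_sphereProb (by fun_prop)) (integrable_sphereProb (by fun_prop)),
    integral_sub (integrable_sphereProb hφ) (integrable_sphereProb (by fun_prop)),
    integral_sphereProb_linear, integral_sphereProb_bilinear, integral_const, probReal_univ,
    one_smul, sub_zero]

section SecondOrderTest

variable {E : Type*} [NormedAddCommGroup E] [NormedSpace ℝ E] {g : E → ℝ} {x : E}

theorem eventually_continuous_sphere (hg : ContDiffAt ℝ 2 g x) (T : ℍ[ℝ] →L[ℝ] E) :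
    ∀ᶠ r : ℝ in 𝓝 0, Continuous fun ξ : sphere (0 : ℍ[ℝ]) 1 => g (x + r • T ξ) := by
  filter_upwards [eventually_forall_add_smul_mem T (hg.eventually (by simp))] with r hr
  refine continuous_iff_continuousAt.2 fun ξ => ?_
  exact (hr ξ (sphere_subset_closedBall ξ.2)).continuousAt.comp
    (f := fun ξ : sphere (0 : ℍ[ℝ]) 1 => x + r • T ξ) (by fun_prop)

theorem integral_sphereProb_taylor (hg : ContDiffAt ℝ 2 g x) (T : ℍ[ℝ] →L[ℝ] E) :
    (fun r : ℝ => ∫ ξ : sphere (0 : ℍ[ℝ]) 1, g (x + r • T ξ) ∂sphereProb - g x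
        - r ^ 2 * (8⁻¹ * ∑ e, fderiv ℝ (fderiv ℝ g) x (T (unitQ e)) (T (unitQ e))))
      =o[𝓝 0] fun r => r ^ 2 := by
  set B := fderiv ℝ (fderiv ℝ g) x
  refine Asymptotics.isLittleO_iff.2 fun ε hε => ?_
  obtain ⟨c, hc, hcε⟩ : ∃ c > 0, ‖T‖ ^ 2 * c < ε := exists_pos_mul_lt hε _
  filter_upwards [eventually_continuous_sphere hg T, eventually_forall_add_smul_mem T
    (Asymptotics.isLittleO_iff.1 (taylor_two_isLittleO hg) hc)] with r hcont hr
  let L : ℍ[ℝ] →L[ℝ] ℝ := r • (fderiv ℝ g x ∘L T)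
  let C : ℍ[ℝ] →L[ℝ] ℍ[ℝ] →L[ℝ] ℝ := (2⁻¹ * r ^ 2) • B.bilinearComp T T
  have hrem : ∀ ξ : sphere (0 : ℍ[ℝ]) 1,
      ‖g (x + r • T ξ) - g x - L ξ - C ξ ξ‖ ≤ ε * r ^ 2 := fun ξ => by
    have hT : ‖T ξ‖ ≤ ‖T‖ := by simpa using T.le_opNorm ξ
    calc ‖g (x + r • T ξ) - g x - L ξ - C ξ ξ‖
        = ‖g (x + r • T ξ) - g x - fderiv ℝ g x (x + r • T ξ - x)
            - (2⁻¹ : ℝ) • B (x + r • T ξ - x) (x + r • T ξ - x)‖ := by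
          simp [L, C, mul_assoc, sq]
      _ ≤ c * ‖‖x + r • T ξ - x‖ ^ 2‖ := hr ξ (sphere_subset_closedBall ξ.2)
      _ = c * ‖T ξ‖ ^ 2 * r ^ 2 := by
          rw [add_sub_cancel_left, norm_pow, norm_norm, norm_smul, mul_pow, Real.norm_eq_abs,
            sq_abs]
          ring
      _ ≤ ‖T‖ ^ 2 * c * r ^ 2 := by rw [mul_comm c]; gcongr
      _ ≤ ε * r ^ 2 := by gcongr
  calc _ = ‖∫ ξ : sphere (0 : ℍ[ℝ]) 1, (g (x + r • T ξ) - g x - L ξ - C ξ ξ) ∂sphereProb‖ := by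
        rw [integral_sphereProb_sub_quadratic hcont]
        simp only [C, smul_apply, ContinuousLinearMap.bilinearComp_apply, smul_eq_mul,
          ← Finset.mul_sum]
        ring_nf
    _ ≤ ε * r ^ 2 := by
        simpa using norm_integral_le_of_norm_le_const (μ := sphereProb) (.of_forall hrem)
    _ = ε * ‖r ^ 2‖ := by rw [Real.norm_of_nonneg (sq_nonneg r)]

theorem sum_sndFDeriv_nonneg_of_le_integral (hg : ContDiffAt ℝ 2 g x) (T : ℍ[ℝ] →L[ℝ] E)
    (hmean : ∀ᶠ r : ℝ in 𝓝[>] 0, g x ≤ ∫ ξ : sphere (0 : ℍ[ℝ]) 1, g (x + r • T ξ) ∂sphereProb) :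
    0 ≤ ∑ e, fderiv ℝ (fderiv ℝ g) x (T (unitQ e)) (T (unitQ e)) := by
  refine le_of_forall_pos_le_add fun c hc => ?_
  have htaylor := Asymptotics.isLittleO_iff.1 (integral_sphereProb_taylor hg T)
    (show 0 < 8⁻¹ * c by positivity)
  obtain ⟨r, hr, hrc, hr₀⟩ :=
    (hmean.and ((htaylor.filter_mono nhdsWithin_le_nhds).and self_mem_nhdsWithin)).exists
  have hr2 : 0 < r ^ 2 := pow_pos hr₀ 2
  rw [Real.norm_of_nonneg hr2.le] at hrc
  have := (abs_le.1 hrc).2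
  nlinarith

end SecondOrderTest

/-! ### The Baston element of a real bilinear form -/

/-- `τ` as a real algebra homomorphism. -/
def tauHom : ℍ[ℝ] →ₐ[ℝ] Matrix (Fin 2) (Fin 2) ℂ where
  toFun a := Matrix.of (tau a)
  map_one' := by ext ε δ; fin_cases ε <;> fin_cases δ <;> simp [tau]
  map_mul' a b := by
    ext ε δ
    rw [Matrix.mul_apply, Fin.sum_univ_two]
    fin_cases ε <;> fin_cases δ <;> apply Complex.ext <;> simp [tau] <;> ring
  map_zero' := by ext ε δ; fin_cases ε <;> fin_cases δ <;> simp [tau]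
  map_add' a b := by ext ε δ; fin_cases ε <;> fin_cases δ <;> simp [tau] <;> ring
  commutes' r := by
    ext ε δ
    fin_cases ε <;> fin_cases δ <;> simp [tau, Matrix.algebraMap_matrix_apply]

theorem tauHom_apply (a : ℍ[ℝ]) (ε δ : Fin 2) : tauHom a ε δ = tau a ε δ := rfl

theorem bilinForm_smul_apply {R V : Type*} [CommSemiring R] [AddCommMonoid V] [Module R V] (c : R)
    (B : LinearMap.BilinForm R V) (v w : V) : (c • B) v w = c * B v w := rfl

section BastonElement

variable {n : ℕ} {B : LinearMap.BilinForm ℝ (HSpace n)}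

/-- The value at a point of `∇_{jα} ∇_{kβ} f` for a function `f` with second derivative `B`
there. -/
def nablaCoeff (B : LinearMap.BilinForm ℝ (HSpace n)) (α β : Fin 2) (j k : Fin (2 * n)) : ℂ :=
  ((B (dirRe j α) (dirRe k β) - B (dirIm j α) (dirIm k β) : ℝ) : ℂ) +
    Complex.I * ((B (dirRe j α) (dirIm k β) + B (dirIm j α) (dirRe k β) : ℝ) : ℂ)

/-- The value at a point of `△f` for a function `f` with second derivative `B` there. -/
def bastonElement (B : LinearMap.BilinForm ℝ (HSpace n)) : Ext n :=
  ∑ j, ∑ k, nablaCoeff B 0 1 j k • (omega j * omega k)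

theorem nablaCoeff_sum {ι : Type*} (s : Finset ι) (c : ι → ℝ)
    (B : ι → LinearMap.BilinForm ℝ (HSpace n)) (α β : Fin 2) (j k : Fin (2 * n)) :
    nablaCoeff (∑ i ∈ s, c i • B i) α β j k = ∑ i ∈ s, (c i : ℂ) * nablaCoeff (B i) α β j k := by
  simp only [nablaCoeff, LinearMap.sum_apply, bilinForm_smul_apply, mul_add, mul_sub,
    Finset.sum_add_distrib, Finset.sum_sub_distrib, Complex.ofReal_add, Complex.ofReal_sub,
    Complex.ofReal_sum, Complex.ofReal_mul, Finset.mul_sum, mul_left_comm Complex.I]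

theorem bastonElement_sum {ι : Type*} (s : Finset ι) (c : ι → ℝ)
    (B : ι → LinearMap.BilinForm ℝ (HSpace n)) :
    bastonElement (∑ i ∈ s, c i • B i) = ∑ i ∈ s, (c i : ℂ) • bastonElement (B i) := by
  simp only [bastonElement, nablaCoeff_sum, Finset.sum_smul, Finset.smul_sum, mul_smul]
  rw [Finset.sum_comm (s := s)]
  exact Finset.sum_congr rfl fun j _ => Finset.sum_comm

theorem omega_mul_omega_comm (j k : Fin (2 * n)) :
    (omega j * omega k : Ext n) = -(omega k * omega j) :=
  eq_neg_of_add_eq_zero_left (ExteriorAlgebra.ι_add_mul_swap _ _)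

theorem ι_eq_sum_omega (x : CSpace n) : ExteriorAlgebra.ι ℂ x = ∑ j, x j • (omega j : Ext n) := by
  conv_lhs => rw [pi_eq_sum_univ' x]
  simp only [map_sum, map_smul, omega]

/-- The right linear map `q ↦ ∑ a_l q_l`. -/
def rightLinOf (a : Fin n → ℍ[ℝ]) : RightLin n where
  toFun q := ∑ l, a l * q l
  map_add' p q := by simp [mul_add, Finset.sum_add_distrib]
  map_smul' c q := by simp [Finset.sum_mul, mul_assoc]

theorem rightLinOf_single (a : Fin n → ℍ[ℝ]) (l : Fin n) : rightLinOf a (Pi.single l 1) = a l := by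
  simp [rightLinOf, Pi.single_apply]

theorem exists_rightLin_ne_zero (hn : 1 ≤ n) : ∃ η : RightLin n, η ≠ 0 := by
  refine ⟨rightLinOf fun _ => 1, fun h => ?_⟩
  simpa [h] using rightLinOf_single (fun _ : Fin n => (1 : ℍ[ℝ])) ⟨0, hn⟩

/-- The right linear map with real part `f`. -/
def rightLinOfReal (f : HSpace n →ₗ[ℝ] ℝ) : RightLin n :=
  rightLinOf fun l => (⟨f (Pi.single l 1), -f (Pi.single l unitI), -f (Pi.single l unitJ),
    -f (Pi.single l unitK)⟩ : ℍ[ℝ])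

theorem tau_rightLinOfReal (f : HSpace n →ₗ[ℝ] ℝ) (j : Fin (2 * n)) (α : Fin 2) :
    tau (rightLinOfReal f (Pi.single (blk j) 1)) α (par j)
      = f (dirRe j α) + Complex.I * f (dirIm j α) := by
  have h : rightLinOfReal f (Pi.single (blk j) 1) = (⟨f (Pi.single (blk j) 1),
      -f (Pi.single (blk j) unitI), -f (Pi.single (blk j) unitJ),
      -f (Pi.single (blk j) unitK)⟩ : ℍ[ℝ]) := rightLinOf_single _ _
  rw [h, dirRe, dirIm]
  generalize par j = ε
  fin_cases α <;> fin_cases ε <;> simp [tau, nablaDir, Pi.single_neg]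

theorem bastonElement_linMulLin_self (f : HSpace n →ₗ[ℝ] ℝ) :
    bastonElement (LinearMap.BilinForm.linMulLin f f)
      = pullback (rightLinOfReal f) 0 * pullback (rightLinOfReal f) 1 := by
  rw [pullback, pullback, bastonElement, ι_eq_sum_omega, ι_eq_sum_omega, Finset.sum_mul_sum]
  refine Finset.sum_congr rfl fun j _ => Finset.sum_congr rfl fun k _ => ?_
  rw [tau_rightLinOfReal, tau_rightLinOfReal, smul_mul_smul_comm]
  congr 1
  simp only [nablaCoeff, LinearMap.BilinForm.linMulLin_apply]
  push_cast
  linear_combination (f (dirIm j 0) * f (dirIm k 1) : ℂ) * (-Complex.I_mul_I)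

/-- The form `(v, w) ↦ B(v e, w e)`. -/
def rotForm (B : LinearMap.BilinForm ℝ (HSpace n)) (e : ℍ[ℝ]) :
    LinearMap.BilinForm ℝ (HSpace n) :=
  B.compl₁₂ (rmul.flip e : HSpace n →L[ℝ] HSpace n).toLinearMap
    (rmul.flip e : HSpace n →L[ℝ] HSpace n).toLinearMap

theorem rotForm_apply (B : LinearMap.BilinForm ℝ (HSpace n)) (e : ℍ[ℝ]) (v w : HSpace n) :
    rotForm B e v w = B (rmul v e) (rmul w e) := rfl

theorem rotForm_one (B : LinearMap.BilinForm ℝ (HSpace n)) : rotForm B 1 = B :=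
  LinearMap.ext₂ fun v w => by rw [rotForm_apply, rmul_one, rmul_one]

theorem rotForm_rotForm (B : LinearMap.BilinForm ℝ (HSpace n)) (s t : ℍ[ℝ]) :
    rotForm (rotForm B s) t = rotForm B (t * s) :=
  LinearMap.ext₂ fun v w => by simp only [rotForm_apply, rmul_rmul]

theorem rmul_single (x e : ℍ[ℝ]) (l : Fin n) :
    rmul (Pi.single l x : HSpace n) e = Pi.single l (x * e) :=
  funext fun i => Pi.apply_single (fun _ y => y * e) (fun _ => zero_mul e) l x i

theorem units_mul_table : unitI * unitI = -1 ∧ unitI * unitJ = unitK ∧ unitI * unitK = -unitJ ∧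
    unitJ * unitI = -unitK ∧ unitJ * unitJ = -1 ∧ unitJ * unitK = unitI ∧
    unitK * unitI = unitJ ∧ unitK * unitJ = -unitI ∧ unitK * unitK = -1 := by
  refine ⟨?_, ?_, ?_, ?_, ?_, ?_, ?_, ?_, ?_⟩ <;> ext <;>
    simp [unitI_components, unitJ_components, unitK_components]

theorem rmul_dir_unitI (j : Fin (2 * n)) :
    rmul (dirRe j 0) unitI = dirIm j 0 ∧ rmul (dirIm j 0) unitI = -dirRe j 0 ∧
      rmul (dirRe j 1) unitI = -dirIm j 1 ∧ rmul (dirIm j 1) unitI = dirRe j 1 := by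
  simp only [dirRe, dirIm, rmul_single]
  generalize par j = ε
  fin_cases ε <;> simp [nablaDir, Pi.single_neg, units_mul_table]

theorem rmul_dir_unitJ (j : Fin (2 * n)) :
    rmul (dirRe j 0) unitJ = -dirRe j 1 ∧ rmul (dirIm j 0) unitJ = -dirIm j 1 ∧
      rmul (dirRe j 1) unitJ = dirRe j 0 ∧ rmul (dirIm j 1) unitJ = dirIm j 0 := by
  simp only [dirRe, dirIm, rmul_single]
  generalize par j = ε
  fin_cases ε <;> simp [nablaDir, Pi.single_neg, units_mul_table]

theorem bastonElement_rotForm_unitI (B : LinearMap.BilinForm ℝ (HSpace n)) :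
    bastonElement (rotForm B unitI) = bastonElement B := by
  refine Finset.sum_congr rfl fun j _ => Finset.sum_congr rfl fun k _ => ?_
  congr 1
  simp only [nablaCoeff, rotForm_apply, rmul_dir_unitI, map_neg, LinearMap.neg_apply]
  push_cast
  ring

theorem bastonElement_rotForm_unitJ (hB : B.IsSymm) :
    bastonElement (rotForm B unitJ) = bastonElement B := by
  -- `v ↦ v𝐣` exchanges `∇_{j0}` and `∇_{j1}` up to sign, which the wedge product compensates.
  rw [bastonElement, bastonElement, Finset.sum_comm]
  refine Finset.sum_congr rfl fun j _ => Finset.sum_congr rfl fun k _ => ?_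
  rw [omega_mul_omega_comm k j, smul_neg, ← neg_smul]
  congr 1
  simp only [nablaCoeff, rotForm_apply, rmul_dir_unitJ, map_neg, LinearMap.neg_apply]
  rw [hB.eq (dirRe j 0), hB.eq (dirRe j 0), hB.eq (dirIm j 0), hB.eq (dirIm j 0)]
  push_cast
  ring

theorem bastonElement_rotForm_unitQ (hB : B.IsSymm) (e : Fin 4) :
    bastonElement (rotForm B (unitQ e)) = bastonElement B := by
  have hK : rotForm B unitK = rotForm (rotForm B unitJ) unitI := by
    rw [rotForm_rotForm, units_mul_table.2.1]
  fin_cases e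
  · exact congrArg bastonElement (rotForm_one B)
  · exact bastonElement_rotForm_unitI B
  · exact bastonElement_rotForm_unitJ hB
  · exact (congrArg bastonElement hK).trans
      ((bastonElement_rotForm_unitI _).trans (bastonElement_rotForm_unitJ hB))

/-- The average of `B` over right multiplications by `1, 𝐢, 𝐣, 𝐤`. -/
def quatAverage (B : LinearMap.BilinForm ℝ (HSpace n)) : LinearMap.BilinForm ℝ (HSpace n) :=
  ∑ e, (4⁻¹ : ℝ) • rotForm B (unitQ e)

theorem quatAverage_apply (B : LinearMap.BilinForm ℝ (HSpace n)) (v w : HSpace n) :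
    quatAverage B v w = 4⁻¹ * ∑ e, B (rmul v (unitQ e)) (rmul w (unitQ e)) := by
  simp [quatAverage, LinearMap.sum_apply, Finset.mul_sum, rotForm_apply]

theorem isSymm_quatAverage (hB : B.IsSymm) : (quatAverage B).IsSymm :=
  ⟨fun v w => by simp only [quatAverage_apply, hB.eq (rmul v _)]⟩

theorem bastonElement_quatAverage (hB : B.IsSymm) :
    bastonElement (quatAverage B) = bastonElement B := by
  rw [quatAverage, bastonElement_sum]
  simp only [bastonElement_rotForm_unitQ hB]
  rw [← Finset.sum_smul]
  simp

end BastonElement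

theorem eq_sum_smul_linMulLin_coord {R V ι : Type*} [CommRing R] [AddCommGroup V] [Module R V]
    [Fintype ι] {Q : LinearMap.BilinForm R V} {b : Module.Basis ι R V} (hb : Q.iIsOrtho b) :
    Q = ∑ i, Q (b i) (b i) • LinearMap.BilinForm.linMulLin (b.coord i) (b.coord i) := by
  classical
  refine b.ext fun i => b.ext fun j => ?_
  simp only [LinearMap.sum_apply, bilinForm_smul_apply,
    LinearMap.BilinForm.linMulLin_apply,
    Module.Basis.coord_apply, Module.Basis.repr_self, Finsupp.single_apply, mul_ite,
    mul_one, mul_zero, Finset.sum_ite_eq, Finset.mem_univ, if_true]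
  obtain rfl | hij := eq_or_ne i j
  · rw [if_pos rfl]
  · rw [if_neg hij]
    exact hb hij

section StrongPositivity

variable {n : ℕ}

theorem pullback_zero (ε : Fin 2) : pullback (0 : RightLin n) ε = 0 := by
  have h : ∀ δ, tau 0 ε δ = 0 := fun δ => congrFun₂ (map_zero tauHom) ε δ
  simp only [pullback, LinearMap.zero_apply, h]
  exact map_zero (ExteriorAlgebra.ι ℂ (M := CSpace n))

theorem isElementaryStronglyPositive_one {η : RightLin n} (hη : η ≠ 0) :
    IsElementaryStronglyPositive 1 (pullback η 0 * pullback η 1) :=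
  ⟨fun _ => η, linearIndependent_unique_iff.2 hη, by simp⟩

theorem isStronglyPositive_one_sum (hn : 1 ≤ n) {m : ℕ} {c : Fin m → ℝ} (hc : ∀ i, 0 ≤ c i)
    (η : Fin m → RightLin n) :
    IsStronglyPositive 1 (∑ i, (c i : ℂ) • (pullback (η i) 0 * pullback (η i) 1)) := by
  obtain ⟨η₀, hη₀⟩ := exists_rightLin_ne_zero hn
  have hterm : ∀ i, ∃ (d : ℝ) (ξ : Ext n), 0 ≤ d ∧ IsElementaryStronglyPositive 1 ξ ∧
      (c i : ℂ) • (pullback (η i) 0 * pullback (η i) 1) = (d : ℂ) • ξ := fun i => by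
    obtain h | h := eq_or_ne (η i) 0
    · exact ⟨0, _, le_rfl, isElementaryStronglyPositive_one hη₀, by simp [h, pullback_zero]⟩
    · exact ⟨c i, _, hc i, isElementaryStronglyPositive_one h, rfl⟩
  choose d ξ hd hξ heq using hterm
  exact ⟨m, d, ξ, hd, hξ, Finset.sum_congr rfl fun i _ => heq i⟩

theorem isStronglyPositive_bastonElement (hn : 1 ≤ n) {B : LinearMap.BilinForm ℝ (HSpace n)}
    (hB : B.IsSymm) (hpos : ∀ v, 0 ≤ ∑ e, B (rmul v (unitQ e)) (rmul v (unitQ e))) :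
    IsStronglyPositive 1 (bastonElement B) := by
  obtain ⟨b, hb⟩ := LinearMap.BilinForm.exists_orthogonal_basis
    (LinearMap.BilinForm.isSymm_iff.1 (isSymm_quatAverage hB))
  rw [← bastonElement_quatAverage hB, eq_sum_smul_linMulLin_coord hb, bastonElement_sum]
  simp only [bastonElement_linMulLin_self]
  refine isStronglyPositive_one_sum hn (fun i => ?_) _
  rw [quatAverage_apply]
  exact mul_nonneg (by norm_num) (hpos _)

end StrongPositivity

/-! ### The complex determinant of a quaternionic matrix -/

theorem det_tauHom (a : ℍ[ℝ]) : (tauHom a).det = ((‖a‖ ^ 2 : ℝ) : ℂ) := by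
  rw [sq, ← Quaternion.normSq_eq_norm_mul_self, Quaternion.normSq_def', Matrix.det_fin_two]
  simp only [tauHom_apply, tau]
  apply Complex.ext <;> simp [sq] <;> ring

theorem continuous_tauHom : Continuous tauHom :=
  tauHom.toLinearMap.continuous_of_finiteDimensional

/-- The complex matrix obtained from a quaternionic matrix `A` by replacing each entry `a` by the
block `τ(a)`. -/
def tauBlock {m : Type*} (A : Matrix m m ℍ[ℝ]) : Matrix (m × Fin 2) (m × Fin 2) ℂ :=
  Matrix.comp m m (Fin 2) (Fin 2) ℂ (A.map tauHom)

theorem continuous_tauBlock {m : Type*} : Continuous (tauBlock (m := m)) :=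
  continuous_matrix fun p q =>
    (continuous_tauHom.comp (continuous_apply_apply p.1 q.1)).matrix_elem p.2 q.2

/-- The splitting of the indices of a `(k + 1) × (k + 1)` block matrix that isolates the upper left
block. -/
def succBlockEquiv (k : ℕ) : Fin 2 ⊕ Fin k × Fin 2 ≃ Fin (k + 1) × Fin 2 where
  toFun := Sum.elim (fun ε => (0, ε)) fun p => (p.1.succ, p.2)
  invFun p := Fin.cases (motive := fun _ => Fin 2 ⊕ Fin k × Fin 2) (Sum.inl p.2)
    (fun i => Sum.inr (i, p.2)) p.1
  left_inv := by rintro (ε | ⟨i, ε⟩) <;> simp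
  right_inv := by
    rintro ⟨i, ε⟩
    refine Fin.cases ?_ (fun i => ?_) i <;> simp

/-- The Schur complement of the upper left entry of a quaternionic matrix. -/
def schurCompl {k : ℕ} (A : Matrix (Fin (k + 1)) (Fin (k + 1)) ℍ[ℝ]) :
    Matrix (Fin k) (Fin k) ℍ[ℝ] :=
  Matrix.of fun i l => A i.succ l.succ - A i.succ 0 * (A 0 0)⁻¹ * A 0 l.succ

theorem det_tauBlock_eq_mul_schurCompl {k : ℕ} (A : Matrix (Fin (k + 1)) (Fin (k + 1)) ℍ[ℝ])
    (h : A 0 0 ≠ 0) :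
    (tauBlock A).det = ((‖A 0 0‖ ^ 2 : ℝ) : ℂ) * (tauBlock (schurCompl A)).det := by
  let _ : Invertible (A 0 0) := invertibleOfNonzero h
  let _ : Invertible (tauHom (A 0 0)) := Invertible.map tauHom (A 0 0)
  have hblock : (tauBlock A).submatrix (succBlockEquiv k) (succBlockEquiv k)
      = Matrix.fromBlocks (tauHom (A 0 0)) (Matrix.of fun ε q => tauHom (A 0 q.1.succ) ε q.2)
        (Matrix.of fun p δ => tauHom (A p.1.succ 0) p.2 δ)
        (tauBlock (Matrix.of fun i l => A i.succ l.succ)) := by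
    ext (ε | ⟨i, ε⟩) (δ | ⟨l, δ⟩) <;> rfl
  rw [← Matrix.det_submatrix_equiv_self (succBlockEquiv k), hblock, Matrix.det_fromBlocks₁₁,
    det_tauHom, ← map_invOf tauHom, invOf_eq_inv]
  refine congrArg _ (congrArg Matrix.det (Matrix.ext fun p q => ?_))
  have hentry := congrFun₂ (map_sub tauHom (A p.1.succ q.1.succ)
    (A p.1.succ 0 * (A 0 0)⁻¹ * A 0 q.1.succ)) p.2 q.2
  rw [map_mul, map_mul] at hentry
  exact hentry.symm

theorem det_tauBlock_nonneg {k : ℕ} (A : Matrix (Fin k) (Fin k) ℍ[ℝ]) :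
    0 ≤ (tauBlock A).det := by
  induction k with
  | zero => simp
  | succ k ih =>
    have hcorner : ∀ A : Matrix (Fin (k + 1)) (Fin (k + 1)) ℍ[ℝ], A 0 0 ≠ 0 →
        0 ≤ (tauBlock A).det := fun A hA => by
      rw [det_tauBlock_eq_mul_schurCompl A hA]
      exact mul_nonneg (by exact_mod_cast sq_nonneg ‖A 0 0‖) (ih _)
    obtain hA | hA := ne_or_eq (A 0 0) 0
    · exact hcorner A hA
    -- Adding a small real multiple of the identity makes the corner entry nonzero.
    have hcont : Continuous fun t : ℝ => (tauBlock (A + t • 1)).det :=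
      (continuous_tauBlock.comp (by fun_prop)).matrix_det
    have hlim : Tendsto (fun t : ℝ => (tauBlock (A + t • 1)).det) (𝓝[≠] 0)
        (𝓝 (tauBlock A).det) := by
      simpa only [zero_smul, add_zero] using (hcont.tendsto 0).mono_left nhdsWithin_le_nhds
    refine ge_of_tendsto hlim (eventually_mem_nhdsWithin.mono fun t ht => hcorner _ ?_)
    simpa [hA] using ht

/-! ### Strongly positive elements of complementary degree -/

section Pairing

variable {n : ℕ}

/-- The indices `j = 2l + ε` of `ℂ²ⁿ` as pairs `(l, ε)`. -/
def blkParEquiv (n : ℕ) : Fin (2 * n) ≃ Fin n × Fin 2 where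
  toFun j := (blk j, par j)
  invFun p := ⟨2 * p.1 + p.2, by have := p.1.2; have := p.2.2; omega⟩
  left_inv j := by ext; simp [blk, par]; omega
  right_inv p := by
    have := p.2.2
    ext <;> simp [blk, par] <;> omega

theorem blkParEquiv_mk (i : Fin n) (ε : Fin 2) (h : 2 * (i : ℕ) + ε < 2 * n) :
    (blk ⟨2 * i + ε, h⟩ : Fin n) = i ∧ par (⟨2 * i + ε, h⟩ : Fin (2 * n)) = ε :=
  Prod.ext_iff.1 ((blkParEquiv n).apply_symm_apply (i, ε))

theorem prod_ofFn_pullback (η : Fin n → RightLin n) :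
    (List.ofFn fun i => pullback (η i) 0 * pullback (η i) 1).prod
      = ExteriorAlgebra.ιMulti ℂ (2 * n) (fun j : Fin (2 * n) => fun k : Fin (2 * n) =>
          tau (η (blk j) (Pi.single (blk k) 1)) (par j) (par k)) := by
  rw [ExteriorAlgebra.ιMulti_apply, List.ofFn_mul', List.prod_flatten, List.map_ofFn]
  congr 2
  ext1 i
  simp only [Function.comp, List.ofFn_succ, List.ofFn_zero, List.prod_cons, List.prod_nil, mul_one,
    Fin.succ_zero_eq_one, blkParEquiv_mk, pullback]

theorem topCoeff_prod_pullback (η : Fin n → RightLin n) :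
    topCoeff n (List.ofFn fun i => pullback (η i) 0 * pullback (η i) 1).prod
      = (tauBlock (Matrix.of fun i l => η i (Pi.single l 1))).det := by
  rw [prod_ofFn_pullback, topCoeff, ExteriorAlgebra.liftAlternating_apply_ιMulti,
    Pi.single_eq_same, ← Matrix.det_submatrix_equiv_self (blkParEquiv n)]
  rfl

theorem topCoeff_mul_nonneg {k l : ℕ} (hkl : k + l = n) {x y : Ext n} (hx : IsStronglyPositive k x)
    (hy : IsStronglyPositive l y) : 0 ≤ topCoeff n (x * y) := by
  subst hkl
  obtain ⟨p, c, ξ, hc, hξ, rfl⟩ := hx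
  obtain ⟨q, d, ζ, hd, hζ, rfl⟩ := hy
  have helem : ∀ i j, 0 ≤ topCoeff (k + l) (ξ i * ζ j) := fun i j => by
    obtain ⟨η, -, h1⟩ := hξ i
    obtain ⟨θ, -, h2⟩ := hζ j
    have hdet := det_tauBlock_nonneg (Matrix.of fun i j => Fin.append η θ i (Pi.single j 1))
    rw [← topCoeff_prod_pullback, List.ofFn_add, List.prod_append] at hdet
    simpa only [h1, h2, Fin.append_left', Fin.append_right] using hdet
  simp only [Finset.sum_mul_sum, map_sum, smul_mul_smul_comm, map_smul, smul_eq_mul]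
  refine Finset.sum_nonneg fun i _ => Finset.sum_nonneg fun j _ => mul_nonneg ?_ (helem i j)
  exact_mod_cast mul_nonneg (hc i) (hd j)

end Pairing

/-! ### The operators `∇_{jα}` and `d_α` on functions and forms -/

section Nabla

variable {n : ℕ} {W : Type*} [NormedAddCommGroup W] [NormedSpace ℂ W]
  {V : Type*} [NormedAddCommGroup V] [NormedSpace ℂ V]

theorem contDiffAt_nabla {m p : WithTop ℕ∞} {F : HSpace n → W} {q : HSpace n}
    (hF : ContDiffAt ℝ p F q) (hm : m + 1 ≤ p) (j : Fin (2 * n)) (α : Fin 2) :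
    ContDiffAt ℝ m (nabla j α F) q := by
  have h := hF.fderiv_right hm
  exact (h.clm_apply contDiffAt_const).add ((h.clm_apply contDiffAt_const).const_smul _)

theorem contDiff_nabla {m p : WithTop ℕ∞} {F : HSpace n → W} (hF : ContDiff ℝ p F) (hm : m + 1 ≤ p)
    (j : Fin (2 * n)) (α : Fin 2) : ContDiff ℝ m (nabla j α F) :=
  contDiff_iff_contDiffAt.2 fun _ => contDiffAt_nabla hF.contDiffAt hm j α

theorem nabla_congr {F G : HSpace n → W} {q : HSpace n} (h : F =ᶠ[𝓝 q] G) (j : Fin (2 * n))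
    (α : Fin 2) : nabla j α F q = nabla j α G q := by
  simp only [nabla, h.fderiv_eq]

theorem nabla_clm {F : HSpace n → W} {q : HSpace n} (hF : DifferentiableAt ℝ F q)
    (L : W →L[ℂ] V) (j : Fin (2 * n)) (α : Fin 2) :
    nabla j α (fun x => L (F x)) q = L (nabla j α F q) := by
  have h : fderiv ℝ (fun x => L (F x)) q = (L.restrictScalars ℝ).comp (fderiv ℝ F q) :=
    ((L.restrictScalars ℝ).hasFDerivAt.comp q hF.hasFDerivAt).fderiv
  simp [nabla, h]

theorem nabla_nabla_clm {F : HSpace n → W} {q : HSpace n} (hF : ContDiffAt ℝ 2 F q)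
    (L : W →L[ℂ] V) (j k : Fin (2 * n)) (α β : Fin 2) :
    nabla j α (nabla k β fun x => L (F x)) q = L (nabla j α (nabla k β F) q) := by
  have hev : nabla k β (fun x => L (F x)) =ᶠ[𝓝 q] fun x => L (nabla k β F x) := by
    filter_upwards [hF.eventually (by simp)] with x hx
    exact nabla_clm (hx.differentiableAt (by simp)) L k β
  rw [nabla_congr hev, nabla_clm]
  exact (contDiffAt_nabla (m := 1) hF (by norm_num) k β).differentiableAt (by simp)

theorem nabla_sum {ι : Type*} (s : Finset ι) {F : ι → HSpace n → W} {q : HSpace n}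
    (hF : ∀ i ∈ s, DifferentiableAt ℝ (F i) q) (j : Fin (2 * n)) (α : Fin 2) :
    nabla j α (fun x => ∑ i ∈ s, F i x) q = ∑ i ∈ s, nabla j α (F i) q := by
  simp only [nabla, fderiv_fun_sum hF, FunLike.coe_sum, Finset.sum_apply,
    Finset.smul_sum, Finset.sum_add_distrib]

theorem nabla_nabla {F : HSpace n → W} {q : HSpace n} (hF : ContDiffAt ℝ 2 F q)
    (j k : Fin (2 * n)) (α β : Fin 2) :
    nabla j α (nabla k β F) q =
      (fderiv ℝ (fderiv ℝ F) q (dirRe j α) (dirRe k β)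
        - fderiv ℝ (fderiv ℝ F) q (dirIm j α) (dirIm k β))
      + Complex.I • (fderiv ℝ (fderiv ℝ F) q (dirRe j α) (dirIm k β)
        + fderiv ℝ (fderiv ℝ F) q (dirIm j α) (dirRe k β)) := by
  have hd : DifferentiableAt ℝ (fderiv ℝ F) q :=
    (hF.fderiv_right (m := 1) (by norm_num)).differentiableAt (by simp)
  have h1 : ∀ v : HSpace n, HasFDerivAt (fun x => fderiv ℝ F x v)
      ((fderiv ℝ (fderiv ℝ F) q).flip v) q := fun v => by
    have := hd.hasFDerivAt.clm_apply (hasFDerivAt_const v q)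
    refine this.congr_fderiv ?_
    ext w; simp
  have h2 : fderiv ℝ (nabla k β F) q = (fderiv ℝ (fderiv ℝ F) q).flip (dirRe k β)
      + Complex.I • (fderiv ℝ (fderiv ℝ F) q).flip (dirIm k β) :=
    ((h1 _).add ((h1 _).const_smul Complex.I)).fderiv
  rw [nabla, h2]
  simp only [add_apply, smul_apply, ContinuousLinearMap.flip_apply,
    smul_add, smul_smul, Complex.I_mul_I, neg_smul, one_smul]
  abel

theorem nabla_comm {F : HSpace n → W} {q : HSpace n} (hF : ContDiffAt ℝ 2 F q)
    (j k : Fin (2 * n)) (α β : Fin 2) :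
    nabla j α (nabla k β F) q = nabla k β (nabla j α F) q := by
  have hsym : ∀ v w, fderiv ℝ (fderiv ℝ F) q v w = fderiv ℝ (fderiv ℝ F) q w v :=
    hF.isSymmSndFDerivAt (by simp)
  rw [nabla_nabla hF, nabla_nabla hF, hsym (dirRe j α), hsym (dirRe j α), hsym (dirIm j α),
    hsym (dirIm j α), add_comm (fderiv ℝ (fderiv ℝ F) q (dirIm k β) (dirRe j α))]

theorem support_nabla_subset {F : HSpace n → W} (j : Fin (2 * n)) (α : Fin 2) :
    Function.support (nabla j α F) ⊆ tsupport F := fun q hq => by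
  contrapose! hq
  simp [nabla, fderiv_of_notMem_tsupport ℝ hq]

theorem tsupport_nabla_subset {F : HSpace n → W} (j : Fin (2 * n)) (α : Fin 2) :
    tsupport (nabla j α F) ⊆ tsupport F :=
  closure_minimal (support_nabla_subset j α) (isClosed_tsupport F)

end Nabla

theorem toExt_wedgeLeft {n k m : ℕ} (h : k + 1 = m) (j : Fin (2 * n)) (x : ExtPow n k) :
    toExt (wedgeLeft h j x) = omega j * toExt x := rfl

theorem toExt_injective {n p : ℕ} : Function.Injective (toExt : ExtPow n p → Ext n) :=
  Subtype.val_injective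

theorem wedgeLeft_wedgeLeft_comm {n p k m : ℕ} (h : k + 1 = m) (h' : p + 1 = k)
    (i j : Fin (2 * n)) (x : ExtPow n p) :
    wedgeLeft h i (wedgeLeft h' j x) = -wedgeLeft h j (wedgeLeft h' i x) := by
  apply toExt_injective
  rw [map_neg, toExt_wedgeLeft, toExt_wedgeLeft, toExt_wedgeLeft, toExt_wedgeLeft, ← mul_assoc,
    omega_mul_omega_comm, neg_mul, mul_assoc]

theorem contDiffAt_dForm {n k l : ℕ} {m p : WithTop ℕ∞} {F : HSpace n → ExtPow n k}
    {q : HSpace n} (hF : ContDiffAt ℝ p F q) (hm : m + 1 ≤ p) (α : Fin 2) (h : k + 1 = l) :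
    ContDiffAt ℝ m (dForm α h F) q := by
  unfold dForm
  refine ContDiffAt.sum fun j _ => ?_
  exact ((wedgeLeft h j).restrictScalars ℝ).contDiff.contDiffAt.comp q (contDiffAt_nabla hF hm j α)

theorem dForm_dForm {n p k m : ℕ} (h : k + 1 = m) (h' : p + 1 = k) {F : HSpace n → ExtPow n p}
    {q : HSpace n} (hF : ContDiffAt ℝ 2 F q) (α β : Fin 2) :
    dForm α h (dForm β h' F) q
      = ∑ i, ∑ j, wedgeLeft h i (wedgeLeft h' j (nabla i α (nabla j β F) q)) := by
  have hd : ∀ j, DifferentiableAt ℝ (nabla j β F) q := fun j =>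
    (contDiffAt_nabla (m := 1) hF (by norm_num) j β).differentiableAt (by simp)
  unfold dForm
  refine Finset.sum_congr rfl fun i _ => ?_
  rw [nabla_sum, map_sum]
  · refine Finset.sum_congr rfl fun j _ => ?_
    rw [nabla_clm (hd j)]
  · intro j _
    exact ((wedgeLeft h' j).restrictScalars ℝ).differentiableAt.comp q (hd j)

theorem dForm_anticomm {n p k m : ℕ} (h : k + 1 = m) (h' : p + 1 = k) {F : HSpace n → ExtPow n p}
    {q : HSpace n} (hF : ContDiffAt ℝ 2 F q) (α β : Fin 2) :
    dForm α h (dForm β h' F) q = -dForm β h (dForm α h' F) q := by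
  rw [dForm_dForm h h' hF, dForm_dForm h h' hF, Finset.sum_comm]
  simp only [← Finset.sum_neg_distrib]
  refine Finset.sum_congr rfl fun j _ => Finset.sum_congr rfl fun i _ => ?_
  rw [wedgeLeft_wedgeLeft_comm, nabla_comm hF]

theorem dForm_dForm_self {n p k m : ℕ} (h : k + 1 = m) (h' : p + 1 = k)
    {F : HSpace n → ExtPow n p} {q : HSpace n} (hF : ContDiffAt ℝ 2 F q) (α : Fin 2) :
    dForm α h (dForm α h' F) q = 0 := by
  have h1 := dForm_anticomm h h' hF α α
  have h2 : (2 : ℂ) • dForm α h (dForm α h' F) q = 0 := by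
    rw [two_smul]
    nth_rw 1 [h1]
    exact neg_add_cancel _
  exact (smul_eq_zero.1 h2).resolve_left two_ne_zero

theorem dForm_congr {n k m : ℕ} {α : Fin 2} {h : k + 1 = m} {F G : HSpace n → ExtPow n k}
    {q : HSpace n} (hFG : F =ᶠ[𝓝 q] G) : dForm α h F q = dForm α h G q := by
  unfold dForm
  refine Finset.sum_congr rfl fun j _ => ?_
  rw [nabla_congr hFG]

theorem dForm_neg {n k m : ℕ} {α : Fin 2} {h : k + 1 = m} {F : HSpace n → ExtPow n k}
    {q : HSpace n} : dForm α h (fun x => -F x) q = -dForm α h F q := by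
  simp only [dForm, nabla, fderiv_fun_neg, neg_apply, smul_neg, map_add, map_neg,
    Finset.sum_add_distrib, Finset.sum_neg_distrib]
  abel

theorem dForm_dForm_dForm {n p k l m : ℕ} (h : l + 1 = m) (h' : k + 1 = l) (h'' : p + 1 = k)
    {F : HSpace n → ExtPow n p} {q : HSpace n} (hF : ContDiffAt ℝ 3 F q) (α : Fin 2) :
    dForm α h (dForm 0 h' (dForm 1 h'' F)) q = 0 := by
  have h2 : ∀ β, ContDiffAt ℝ 2 (dForm β h'' F) q := fun β =>
    contDiffAt_dForm hF (by norm_num) β h''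
  have hev : dForm 0 h' (dForm 1 h'' F) =ᶠ[𝓝 q] fun x => -dForm 1 h' (dForm 0 h'' F) x := by
    filter_upwards [hF.eventually (by simp)] with x hx
    exact dForm_anticomm h' h'' (hx.of_le (by norm_num)) 0 1
  match α with
  | 0 => exact dForm_dForm_self h h' (h2 1) 0
  | 1 => rw [dForm_congr hev, dForm_neg, dForm_dForm_self h h' (h2 0) 1, neg_zero]

theorem tsupport_dForm_subset {n k m : ℕ} {α : Fin 2} {h : k + 1 = m} {F : HSpace n → ExtPow n k} :
    tsupport (dForm α h F) ⊆ tsupport F := by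
  refine closure_minimal (fun q hq => ?_) (isClosed_tsupport F)
  contrapose! hq
  simp [dForm, nabla, fderiv_of_notMem_tsupport ℝ hq]

/-! ### The Baston operator on real functions -/

theorem fderiv_fderiv_clm_comp {E F G : Type*} [NormedAddCommGroup E] [NormedSpace ℝ E]
    [NormedAddCommGroup F] [NormedSpace ℝ F] [NormedAddCommGroup G] [NormedSpace ℝ G]
    (L : F →L[ℝ] G) {f : E → F} {x : E} (hf : ContDiffAt ℝ 2 f x) (v w : E) :
    fderiv ℝ (fderiv ℝ fun y => L (f y)) x v w = L (fderiv ℝ (fderiv ℝ f) x v w) := by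
  have hev : (fderiv ℝ fun y => L (f y)) =ᶠ[𝓝 x]
      fun y => ContinuousLinearMap.compL ℝ E F G L (fderiv ℝ f y) := by
    filter_upwards [hf.eventually (by simp)] with y hy
    exact (L.hasFDerivAt.comp y (hy.differentiableAt (by simp)).hasFDerivAt).fderiv
  have hd : DifferentiableAt ℝ (fderiv ℝ f) x :=
    (hf.fderiv_right (m := 1) (by norm_num)).differentiableAt (by simp)
  have hcomp := (ContinuousLinearMap.compL ℝ E F G L).hasFDerivAt.comp x hd.hasFDerivAt
  rw [hev.fderiv_eq]
  exact congr($hcomp.fderiv v w)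

section Hessian

variable {n : ℕ} {v : HSpace n → ℝ} {q : HSpace n}

/-- The second derivative of `v` at `q` as a bilinear form. -/
def hessianForm (v : HSpace n → ℝ) (q : HSpace n) : LinearMap.BilinForm ℝ (HSpace n) :=
  (fderiv ℝ (fderiv ℝ v) q).toLinearMap₁₂

theorem hessianForm_apply (v : HSpace n → ℝ) (q x y : HSpace n) :
    hessianForm v q x y = fderiv ℝ (fderiv ℝ v) q x y := rfl

theorem isSymm_hessianForm (hv : ContDiffAt ℝ 2 v q) : (hessianForm v q).IsSymm :=
  ⟨fun x y => (hv.isSymmSndFDerivAt (by simp)) x y⟩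

theorem nabla_nabla_ofReal_smul {W : Type*} [NormedAddCommGroup W] [NormedSpace ℂ W]
    (hv : ContDiffAt ℝ 2 v q) (c : W) (j k : Fin (2 * n)) (α β : Fin 2) :
    nabla j α (nabla k β fun x => (v x : ℂ) • c) q = nablaCoeff (hessianForm v q) α β j k • c := by
  have hvc : ContDiffAt ℝ 2 (fun x => (v x : ℂ) • c) q :=
    (Complex.ofRealCLM.smulRight c).contDiff.contDiffAt.comp q hv
  have hD : ∀ x y, fderiv ℝ (fderiv ℝ fun x => (v x : ℂ) • c) q x y
      = (hessianForm v q x y : ℂ) • c :=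
    fderiv_fderiv_clm_comp (Complex.ofRealCLM.smulRight c) hv
  rw [nabla_nabla hvc]
  simp only [hD, smul_smul, ← add_smul, ← sub_smul, nablaCoeff]
  push_cast
  rfl

theorem continuousAt_nablaCoeff_hessianForm (hv : ContDiffAt ℝ 2 v q) (j k : Fin (2 * n))
    (α β : Fin 2) : ContinuousAt (fun x => nablaCoeff (hessianForm v x) α β j k) q := by
  have h2 := ((hv.fderiv_right (m := 1) (by norm_num)).fderiv_right (m := 0) (by simp)).continuousAt
  have h : ∀ x y, ContinuousAt (fun p => hessianForm v p x y) q := fun x y =>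
    (h2.clm_apply continuousAt_const).clm_apply continuousAt_const
  unfold nablaCoeff
  fun_prop (disch := assumption)

theorem contDiffAt_scalarForm {p : WithTop ℕ∞} (hv : ContDiffAt ℝ p v q) :
    ContDiffAt ℝ p (scalarForm fun q => (v q : ℂ)) q :=
  (Complex.ofRealCLM.smulRight (oneForm n)).contDiff.contDiffAt.comp q hv

theorem toExt_oneForm : toExt (oneForm n) = 1 := rfl

theorem toExt_bastonForm (hv : ContDiffAt ℝ 2 v q) :
    toExt (bastonForm v q) = bastonElement (hessianForm v q) := by
  rw [bastonForm, dForm_dForm _ _ (contDiffAt_scalarForm hv), bastonElement]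
  simp only [map_sum, toExt_wedgeLeft]
  refine Finset.sum_congr rfl fun j _ => Finset.sum_congr rfl fun k _ => ?_
  rw [show nabla j 0 (nabla k 1 (scalarForm fun q => (v q : ℂ))) q = _ from
    nabla_nabla_ofReal_smul hv (oneForm n) j k 0 1, map_smul, toExt_oneForm, mul_smul_comm,
    mul_smul_comm, mul_one]

theorem continuousOn_bastonForm {s : Set (HSpace n)} (hs : IsOpen s) (hv : ContDiffOn ℝ 2 v s) :
    ContinuousOn (bastonForm v) s := fun q hq => by
  have h2 := contDiffAt_scalarForm (hv.contDiffAt (hs.mem_nhds hq))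
  have h1 := contDiffAt_dForm (m := 1) h2 (by norm_num) 1 rfl
  exact (contDiffAt_dForm (m := 0) h1 (by norm_num) 0 rfl).continuousAt.continuousWithinAt

end Hessian

/-! ### Integration by parts -/

theorem integrable_mul_of_continuousAt_tsupport {X R : Type*} [TopologicalSpace X]
    [MeasurableSpace X] [OpensMeasurableSpace X] [NormedRing R] {μ : Measure X}
    [IsFiniteMeasureOnCompacts μ] {f g : X → R} (hf : ∀ x ∈ tsupport g, ContinuousAt f x)
    (hg : Continuous g) (hc : HasCompactSupport g) : Integrable (fun x => f x * g x) μ :=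
  (continuous_of_tsupport fun x hx => (hf x (tsupport_mul_subset_right hx)).mul
    hg.continuousAt).integrable_of_hasCompactSupport hc.mul_left

section IntegrationByParts

variable {n : ℕ} {g w : HSpace n → ℂ}

theorem integral_mul_nabla (hg : ∀ x ∈ tsupport w, ContDiffAt ℝ 1 g x) (hw : ContDiff ℝ 1 w)
    (hc : HasCompactSupport w) (j : Fin (2 * n)) (α : Fin 2) :
    ∫ q, g q * nabla j α w q = -∫ q, nabla j α g q * w q := by
  have hgw' : ∀ v, Integrable fun q => g q * fderiv ℝ w q v := fun v =>
    integrable_mul_of_continuousAt_tsupport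
      (fun x hx => (hg x (tsupport_fderiv_apply_subset ℝ v hx)).continuousAt)
      ((hw.continuous_fderiv (by simp)).clm_apply continuous_const) (hc.fderiv_apply (𝕜 := ℝ) v)
  have hg'w : ∀ v, Integrable fun q => fderiv ℝ g q v * w q := fun v =>
    integrable_mul_of_continuousAt_tsupport
      (fun x hx => ((hg x hx).fderiv_right (m := 0) (by simp)).continuousAt.clm_apply
        continuousAt_const) hw.continuous hc
  have hparts : ∀ v, ∫ q, g q * fderiv ℝ w q v = -∫ q, fderiv ℝ g q v * w q := fun v =>
    integral_mul_fderiv_eq_neg_fderiv_mul_of_integrable (hg'w v) (hgw' v)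
      (integrable_mul_of_continuousAt_tsupport (fun x hx => (hg x hx).continuousAt)
        hw.continuous hc)
      (fun x hx => (hg x hx).differentiableAt (by simp)) fun x _ => hw.differentiable (by simp) x
  simp only [nabla, smul_eq_mul, mul_add, add_mul, mul_left_comm _ Complex.I, mul_assoc Complex.I]
  rw [integral_add (hgw' _) ((hgw' _).const_mul _), integral_add (hg'w _) ((hg'w _).const_mul _),
    integral_const_mul, integral_const_mul, hparts, hparts]
  ring

theorem integral_mul_nabla_nabla (hg : ∀ x ∈ tsupport w, ContDiffAt ℝ 2 g x) (hw : ContDiff ℝ 2 w)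
    (hc : HasCompactSupport w) (j k : Fin (2 * n)) (α β : Fin 2) :
    ∫ q, g q * nabla j α (nabla k β w) q = ∫ q, nabla j α (nabla k β g) q * w q := by
  have hc' : HasCompactSupport (nabla k β w) := hc.mono' (support_nabla_subset k β)
  rw [integral_mul_nabla (fun x hx => (hg x (tsupport_nabla_subset k β hx)).of_le (by norm_num))
      (contDiff_nabla hw (by norm_num) k β) hc',
    integral_mul_nabla (fun x hx => contDiffAt_nabla (hg x hx) (by norm_num) j α)
      (hw.of_le (by norm_num)) hc, neg_neg]
  refine integral_congr_ae (ae_of_all _ fun q => ?_)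
  by_cases hq : q ∈ tsupport w
  · simp only [nabla_comm (hg q hq) j k]
  · simp only [image_eq_zero_of_notMem_tsupport hq, mul_zero]

/-- The linear form `x ↦ ∫ ωʲ ∧ ωᵏ ∧ x`, where `∫ Ω₂ₙ = 1`. -/
def wedgeTop {p : ℕ} (j k : Fin (2 * n)) : ExtPow n p →L[ℂ] ℂ :=
  LinearMap.toContinuousLinearMap
    (topCoeff n ∘ₗ LinearMap.mulLeft ℂ (omega j * omega k) ∘ₗ toExt)

theorem wedgeTop_apply {p : ℕ} (j k : Fin (2 * n)) (x : ExtPow n p) :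
    wedgeTop j k x = topCoeff n (omega j * omega k * toExt x) := rfl

theorem topCoeff_dForm_dForm {p k m : ℕ} (h : k + 1 = m) (h' : p + 1 = k)
    {η : HSpace n → ExtPow n p} {q : HSpace n} (hη : ContDiffAt ℝ 2 η q) (α β : Fin 2) :
    topCoeff n (toExt (dForm α h (dForm β h' η) q))
      = ∑ i, ∑ j, nabla i α (nabla j β fun x => wedgeTop i j (η x)) q := by
  simp only [nabla_nabla_clm hη]
  simp only [dForm_dForm h h' hη, map_sum, toExt_wedgeLeft, wedgeTop_apply, mul_assoc]

theorem topCoeff_bastonElement_mul {p : ℕ} (B : LinearMap.BilinForm ℝ (HSpace n))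
    (x : ExtPow n p) : topCoeff n (bastonElement B * toExt x)
      = ∑ i, ∑ j, nablaCoeff B 0 1 i j * wedgeTop i j x := by
  simp only [bastonElement, Finset.sum_mul, map_sum, smul_mul_assoc, map_smul, smul_eq_mul,
    wedgeTop_apply]

theorem integral_ofReal_mul_nabla_nabla {v : HSpace n → ℝ}
    (hv : ∀ x ∈ tsupport w, ContDiffAt ℝ 2 v x) (hw : ContDiff ℝ 2 w) (hc : HasCompactSupport w)
    (j k : Fin (2 * n)) (α β : Fin 2) :
    ∫ q, (v q : ℂ) * nabla j α (nabla k β w) q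
      = ∫ q, nablaCoeff (hessianForm v q) α β j k * w q := by
  have hg : ∀ x ∈ tsupport w, ContDiffAt ℝ 2 (fun y => (v y : ℂ)) x := fun x hx =>
    Complex.ofRealCLM.contDiff.contDiffAt.comp x (hv x hx)
  rw [integral_mul_nabla_nabla hg hw hc]
  refine integral_congr_ae (ae_of_all _ fun q => ?_)
  by_cases hq : q ∈ tsupport w
  · simpa using congr($(nabla_nabla_ofReal_smul (hv q hq) (1 : ℂ) j k α β) * w q)
  · simp only [image_eq_zero_of_notMem_tsupport hq, mul_zero]

theorem integrable_ofReal_mul_nabla_nabla {v : HSpace n → ℝ}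
    (hv : ∀ x ∈ tsupport w, ContinuousAt v x) (hw : ContDiff ℝ 2 w) (hc : HasCompactSupport w)
    (j k : Fin (2 * n)) (α β : Fin 2) :
    Integrable fun q => (v q : ℂ) * nabla j α (nabla k β w) q :=
  integrable_mul_of_continuousAt_tsupport
    (fun x hx => Complex.continuous_ofReal.continuousAt.comp
      (hv x (tsupport_nabla_subset k β (tsupport_nabla_subset j α hx))))
    (contDiff_nabla (m := 0) (contDiff_nabla (m := 1) hw (by norm_num) k β) (by simp)
      j α).continuous
    ((hc.mono' (support_nabla_subset k β)).mono' (support_nabla_subset j α))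

theorem integral_ofReal_mul_dForm_dForm {p k m : ℕ} (h : k + 1 = m) (h' : p + 1 = k)
    {v : HSpace n → ℝ} {η : HSpace n → ExtPow n p} (hv : ∀ x ∈ tsupport η, ContDiffAt ℝ 2 v x)
    (hη : ContDiff ℝ 2 η) (hc : HasCompactSupport η) :
    ∫ q, (v q : ℂ) * topCoeff n (toExt (dForm 0 h (dForm 1 h' η) q))
      = ∫ q, topCoeff n (bastonElement (hessianForm v q) * toExt (η q)) := by
  let w : Fin (2 * n) → Fin (2 * n) → HSpace n → ℂ := fun i j q => wedgeTop i j (η q)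
  have hw : ∀ i j, ContDiff ℝ 2 (w i j) := fun i j =>
    ((wedgeTop i j).restrictScalars ℝ).contDiff.comp hη
  have hwη : ∀ i j, tsupport (w i j) ⊆ tsupport η := fun i j =>
    tsupport_comp_subset (map_zero (wedgeTop i j)) η
  have hwc : ∀ i j, HasCompactSupport (w i j) := fun i j => hc.comp_left (map_zero _)
  have hvw : ∀ i j, Integrable fun q => (v q : ℂ) * nabla i 0 (nabla j 1 (w i j)) q := fun i j =>
    integrable_ofReal_mul_nabla_nabla (fun x hx => (hv x (hwη i j hx)).continuousAt) (hw i j)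
      (hwc i j) i j 0 1
  have hBw : ∀ i j, Integrable fun q => nablaCoeff (hessianForm v q) 0 1 i j * w i j q :=
    fun i j => integrable_mul_of_continuousAt_tsupport
      (fun x hx => continuousAt_nablaCoeff_hessianForm (hv x (hwη i j hx)) i j 0 1)
      (hw i j).continuous (hwc i j)
  simp only [topCoeff_dForm_dForm h h' hη.contDiffAt, topCoeff_bastonElement_mul, Finset.mul_sum]
  rw [integral_finsetSum _ fun i _ => integrable_finsetSum _ fun j _ => hvw i j,
    integral_finsetSum _ fun i _ => integrable_finsetSum _ fun j _ => hBw i j]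
  refine Finset.sum_congr rfl fun i _ => ?_
  rw [integral_finsetSum _ fun j _ => hvw i j, integral_finsetSum _ fun j _ => hBw i j]
  exact Finset.sum_congr rfl fun j _ => integral_ofReal_mul_nabla_nabla
    (fun x hx => hv x (hwη i j hx)) (hw i j) (hwc i j) i j 0 1

end IntegrationByParts

/-! ### Currents -/

section Currents

variable {n : ℕ} {Ω : Opens (HSpace n)}

/-- The `0`-current `φ ↦ ∫ f φ` of a function `f` which is locally integrable on `Ω` (the zero
current if `f` is not). -/
def functionCurrent (Ω : Opens (HSpace n)) (f : HSpace n → ℂ) : Current Ω 0 :=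
  TestFunction.integralAgainstBilinCLM ((ContinuousLinearMap.mul ℂ ℂ).comp
    (LinearMap.toContinuousLinearMap (topCoeff n ∘ₗ toExt))) volume f

theorem functionCurrent_apply {f : HSpace n → ℂ} (hf : LocallyIntegrableOn f (Ω : Set (HSpace n)))
    (φ : TestForm Ω (2 * n - 0)) :
    functionCurrent Ω f φ = ∫ q, f q * topCoeff n (toExt (φ q)) :=
  (TestFunction.integralAgainstBilinCLM_eq_integral hf).trans
    (integral_congr_ae (ae_of_all _ fun _ => mul_comm _ _))

theorem setIntegral_topCoeff_mul {p : ℕ} (ψ : HSpace n → Ext n) (φ : TestForm Ω p) :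
    ∫ q in (Ω : Set (HSpace n)), topCoeff n (ψ q * toExt (φ q))
      = ∫ q, topCoeff n (ψ q * toExt (φ q)) :=
  setIntegral_eq_integral_of_forall_compl_eq_zero fun q hq => by
    rw [image_eq_zero_of_notMem_tsupport fun h => hq (φ.tsupport_subset h), map_zero, mul_zero,
      map_zero]

theorem isCurrentOf_functionCurrent {f : HSpace n → ℂ}
    (hf : LocallyIntegrableOn f (Ω : Set (HSpace n))) :
    IsCurrentOf (functionCurrent Ω f) (scalarForm f) := by
  refine ⟨fun x hx => ?_, fun φ => ?_⟩
  · obtain ⟨U, hU, h⟩ := hf x hx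
    exact ⟨U, hU, h.smul_const (oneForm n)⟩
  · rw [functionCurrent_apply hf, setIntegral_topCoeff_mul fun q => toExt (scalarForm f q)]
    simp only [scalarForm, map_smul, toExt_oneForm, smul_mul_assoc, one_mul, smul_eq_mul]

theorem locallyIntegrableOn_ofReal {X : Type*} [TopologicalSpace X] [MeasurableSpace X]
    {μ : Measure X} {s : Set X} {f : X → ℝ} (hf : LocallyIntegrableOn f s μ) :
    LocallyIntegrableOn (fun x => (f x : ℂ)) s μ := fun x hx =>
  let ⟨t, ht, h⟩ := hf x hx
  ⟨t, ht, h.ofReal⟩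

theorem contDiff_two_testForm {p : ℕ} (η : TestForm Ω p) : ContDiff ℝ 2 η :=
  η.contDiff.of_le (WithTop.coe_le_coe.2 le_top)

theorem coe_dTest {k m : ℕ} (α : Fin 2) (h : k + 1 = m) (η : TestForm Ω k) :
    ⇑(dTest α h η) = dForm α h η :=
  funext (dTest_apply α h η)

theorem dTest_dTest_comm {p k m : ℕ} (h : k + 1 = m) (h' : p + 1 = k) (α β : Fin 2)
    (η : TestForm Ω p) : dTest α h (dTest β h' η) = -dTest β h (dTest α h' η) := by
  ext q
  simp only [neg_apply, coe_dTest, dForm_anticomm h h' (contDiff_two_testForm η).contDiffAt α β]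

theorem dTest_dTest_self {p k m : ℕ} (h : k + 1 = m) (h' : p + 1 = k) (α : Fin 2)
    (η : TestForm Ω p) : dTest α h (dTest α h' η) = 0 := by
  ext q
  simp only [coe_dTest, dForm_dForm_self h h' (contDiff_two_testForm η).contDiffAt, zero_apply]

theorem dTest_dTest_dTest {p k l m : ℕ} (h : l + 1 = m) (h' : k + 1 = l) (h'' : p + 1 = k)
    (α : Fin 2) (η : TestForm Ω p) : dTest 0 h (dTest 1 h' (dTest α h'' η)) = 0 := by
  match α with
  | 0 => rw [dTest_dTest_comm h' h'', map_neg, dTest_dTest_self h h', neg_zero]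
  | 1 => rw [dTest_dTest_self h' h'', map_zero]

theorem isClosedCurrent_bastonCurrent {p : ℕ} (h : p + 2 ≤ 2 * n) (T : Current Ω p) :
    IsClosedCurrent (bastonCurrent h T) := fun α h' => by
  ext η
  have hη := dTest_dTest_dTest (show (2 * n - (p + 2) + 1) + 1 = 2 * n - p by omega) rfl
    (show 2 * n - (p + 2 + 1) + 1 = 2 * n - (p + 2) by omega) α η
  simp only [dCurrent, bastonCurrent, neg_apply, ContinuousLinearMap.comp_apply, hη, map_zero,
    neg_zero, zero_apply]

theorem bastonCurrent_functionCurrent_apply (h : 0 + 2 ≤ 2 * n) {f : HSpace n → ℂ}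
    (hf : LocallyIntegrableOn f (Ω : Set (HSpace n))) (η : TestForm Ω (2 * n - (0 + 2))) :
    bastonCurrent h (functionCurrent Ω f) η = ∫ q, f q * topCoeff n (toExt
      (dForm 0 (show (2 * n - (0 + 2) + 1) + 1 = 2 * n - 0 by omega) (dForm 1 rfl η) q)) := by
  simp only [bastonCurrent, ContinuousLinearMap.comp_apply, functionCurrent_apply hf, coe_dTest]

theorem isCurrentOf_bastonCurrent_functionCurrent (h : 0 + 2 ≤ 2 * n) {v : HSpace n → ℝ}
    (hv : ContDiffOn ℝ 2 v Ω) :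
    IsCurrentOf (bastonCurrent h (functionCurrent Ω fun q => (v q : ℂ))) (bastonForm v) := by
  have hloc : LocallyIntegrableOn (fun q => (v q : ℂ)) (Ω : Set (HSpace n)) :=
    locallyIntegrableOn_ofReal (hv.continuousOn.locallyIntegrableOn Ω.isOpen.measurableSet)
  have hvq : ∀ q ∈ Ω, ContDiffAt ℝ 2 v q := fun q hq => hv.contDiffAt (Ω.isOpen.mem_nhds hq)
  refine ⟨(continuousOn_bastonForm Ω.isOpen hv).locallyIntegrableOn Ω.isOpen.measurableSet,
    fun φ => ?_⟩
  rw [bastonCurrent_functionCurrent_apply h hloc,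
    integral_ofReal_mul_dForm_dForm _ rfl (fun x hx => hvq x (φ.tsupport_subset hx))
      (contDiff_two_testForm φ) φ.hasCompactSupport,
    ← setIntegral_topCoeff_mul fun q => bastonElement (hessianForm v q)]
  exact setIntegral_congr_fun Ω.isOpen.measurableSet fun q hq => by
    simp only [toExt_bastonForm (hvq q hq)]

end Currents

/-! ### Mollification -/

section Mollification

variable {E F : Type*} [NormedAddCommGroup E] [NormedSpace ℝ E] [FiniteDimensional ℝ E]
  [MeasurableSpace E] [BorelSpace E] [NormedAddCommGroup F] [NormedSpace ℝ F]
  {φ : ContDiffBump (0 : E)} {μ : Measure E} [μ.IsAddHaarMeasure] {w : E → ℝ} {f : E → F}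

/-- The mollification `∫ φ(t) f(x - t) dt` of `f` by a bump function `φ`, normalised to have
integral one. -/
def mollify (φ : ContDiffBump (0 : E)) (μ : Measure E) (f : E → F) : E → F :=
  convolution (φ.normed μ) f (ContinuousLinearMap.lsmul ℝ ℝ) μ

omit [BorelSpace E] [μ.IsAddHaarMeasure] in
theorem mollify_apply (x : E) : mollify φ μ f x = ∫ t, φ.normed μ t • f (x - t) ∂μ := rfl

theorem mollify_eq_integral_sub (x : E) :
    mollify φ μ f x = ∫ y, φ.normed μ (x - y) • f y ∂μ :=
  convolution_eq_swap (ContinuousLinearMap.lsmul ℝ ℝ)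

theorem contDiff_mollify {k : ℕ∞} (hf : LocallyIntegrable f μ) :
    ContDiff ℝ k (mollify φ μ f) :=
  φ.hasCompactSupport_normed.contDiff_convolution_left _ φ.contDiff_normed hf

theorem integrable_normed_smul_comp_sub (hf : LocallyIntegrable f μ) (x : E) :
    Integrable (fun t => φ.normed μ t • f (x - t)) μ :=
  φ.hasCompactSupport_normed.convolutionExists_left (ContinuousLinearMap.lsmul ℝ ℝ)
    φ.continuous_normed hf x

theorem exists_forall_norm_normed_le (φ : ContDiffBump (0 : E)) (μ : Measure E)
    [μ.IsAddHaarMeasure] : ∃ C, ∀ t, ‖φ.normed μ t‖ ≤ C :=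
  φ.hasCompactSupport_normed.exists_bound_of_continuous φ.continuous_normed

theorem norm_mollify_le {C : ℝ} (hf : ∀ x, ‖f x‖ ≤ C) (x : E) : ‖mollify φ μ f x‖ ≤ C := by
  rw [mollify_apply, ← one_mul C, ← φ.integral_normed (μ := μ), ← integral_mul_const]
  refine norm_integral_le_of_norm_le (φ.integrable_normed.mul_const C) (ae_of_all _ fun t => ?_)
  rw [norm_smul, Real.norm_of_nonneg (φ.nonneg_normed t)]
  exact mul_le_mul_of_nonneg_left (hf _) (φ.nonneg_normed t)

theorem integral_mollify_smul [CompleteSpace F] (hw : Integrable w μ) (hf : Integrable f μ) :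
    ∫ x, mollify φ μ w x • f x ∂μ = ∫ y, w y • mollify φ μ f y ∂μ := by
  obtain ⟨C, hC⟩ := exists_forall_norm_normed_le φ μ
  have hint : Integrable (fun p : E × E => φ.normed μ (p.1 - p.2) • w p.2 • f p.1) (μ.prod μ) :=
    (hw.smul_prod hf).swap.bdd_smul C
      (φ.continuous_normed.comp (continuous_fst.sub continuous_snd)).aestronglyMeasurable
      (ae_of_all _ fun p => hC _)
  calc ∫ x, mollify φ μ w x • f x ∂μ
      = ∫ x, ∫ y, φ.normed μ (x - y) • w y • f x ∂μ ∂μ := by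
        refine integral_congr_ae (ae_of_all _ fun x => ?_)
        simp only [mollify_eq_integral_sub, ← smul_assoc]
        exact (integral_smul_const _ _).symm
    _ = ∫ y, ∫ x, φ.normed μ (x - y) • w y • f x ∂μ ∂μ := integral_integral_swap hint
    _ = ∫ y, w y • mollify φ μ f y ∂μ := by
        refine integral_congr_ae (ae_of_all _ fun y => ?_)
        simp only [mollify_eq_integral_sub, ← integral_smul]
        refine integral_congr_ae (ae_of_all _ fun x => ?_)
        simp only [smul_comm (w y), ← φ.normed_neg (x - y), neg_sub]

theorem tendsto_integral_mollify_smul [CompleteSpace F] {ι : Type*} {l : Filter ι}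
    [l.IsCountablyGenerated] {ψ : ι → ContDiffBump (0 : E)}
    (hψ : Tendsto (fun i => (ψ i).rOut) l (𝓝 0)) (hw : Integrable w μ)
    (hf : Continuous f) (hfc : HasCompactSupport f) :
    Tendsto (fun i => ∫ x, mollify (ψ i) μ w x • f x ∂μ) l (𝓝 (∫ x, w x • f x ∂μ)) := by
  obtain ⟨C, hC⟩ := hfc.exists_bound_of_continuous hf
  have hfi := hf.integrable_of_hasCompactSupport (μ := μ) hfc
  simp only [integral_mollify_smul hw hfi]
  refine tendsto_integral_filter_of_dominated_convergence (fun x => ‖w x‖ * C)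
    (Eventually.of_forall fun i => hw.aestronglyMeasurable.smul
      (contDiff_mollify (k := 0) hfi.locallyIntegrable).continuous.aestronglyMeasurable)
    (Eventually.of_forall fun i => ae_of_all _ fun x => ?_) (hw.norm.mul_const C)
    (ae_of_all _ fun x => ?_)
  · rw [norm_smul]
    exact mul_le_mul_of_nonneg_left (norm_mollify_le hC x) (norm_nonneg _)
  · exact (ContDiffBump.convolution_tendsto_right_of_continuous hψ hf x).const_smul (w x)

theorem tendsto_integral_mollify_indicator_smul [CompleteSpace F] {ι : Type*} {l : Filter ι}
    [l.IsCountablyGenerated] {ψ : ι → ContDiffBump (0 : E)}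
    (hψ : Tendsto (fun i => (ψ i).rOut) l (𝓝 0)) {K : Set E} (hw : Integrable (K.indicator w) μ)
    (hf : Continuous f) (hfc : HasCompactSupport f) (hfK : tsupport f ⊆ K) :
    Tendsto (fun i => ∫ x, mollify (ψ i) μ (K.indicator w) x • f x ∂μ) l
      (𝓝 (∫ x, w x • f x ∂μ)) := by
  have hwf (x : E) : K.indicator w x • f x = w x • f x := by
    by_cases hx : x ∈ tsupport f
    · rw [Set.indicator_of_mem (hfK hx)]
    · rw [image_eq_zero_of_notMem_tsupport hx, smul_zero, smul_zero]
  simpa only [hwf] using tendsto_integral_mollify_smul hψ hw hf hfc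

variable {Ξ : Type*} [MeasurableSpace Ξ] {σ : Measure Ξ} [IsFiniteMeasure σ] {T : Ξ → E}

theorem integrable_normed_smul_comp_add_sub (hw : Integrable f μ) (hT : Measurable T) (x : E) :
    Integrable (fun p : Ξ × E => φ.normed μ p.2 • f (x + T p.1 - p.2)) (σ.prod μ) := by
  obtain ⟨C, hC⟩ := exists_forall_norm_normed_le φ μ
  have hmp : MeasurePreserving (fun p : Ξ × E => (p.1, x + T p.1 - p.2)) (σ.prod μ) (σ.prod μ) :=
    (MeasurePreserving.id σ).skew_product (g := fun ξ t => x + T ξ - t) (by fun_prop)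
      (ae_of_all _ fun ξ => (Measure.measurePreserving_sub_left μ (x + T ξ)).map_eq)
  exact (hmp.integrable_comp_of_integrable (hw.comp_snd σ)).bdd_smul C
    (φ.continuous_normed.measurable.comp measurable_snd).aestronglyMeasurable
    (ae_of_all _ fun p => hC _)

theorem mollify_le_integral_mollify (hw : Integrable w μ) (hT : Measurable T) {x : E}
    (hmean : ∀ᵐ t ∂μ, ‖t‖ < φ.rOut → w (x - t) ≤ ∫ ξ, w (x - t + T ξ) ∂σ) :
    mollify φ μ w x ≤ ∫ ξ, mollify φ μ w (x + T ξ) ∂σ := by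
  have hint := integrable_normed_smul_comp_add_sub (φ := φ) (σ := σ) hw hT x
  simp only [mollify_apply]
  rw [integral_integral_swap hint]
  refine integral_mono_ae (integrable_normed_smul_comp_sub hw.locallyIntegrable x)
    hint.integral_prod_right ?_
  filter_upwards [hmean] with t ht
  rw [integral_smul]
  by_cases hφt : φ.normed μ t = 0
  · simp only [hφt, zero_smul, le_refl]
  have htφ : t ∈ Function.support (φ.normed μ) := hφt
  rw [φ.support_normed_eq, mem_ball_zero_iff] at htφ
  simpa only [add_sub_right_comm] using smul_le_smul_of_nonneg_left (ht htφ) (φ.nonneg_normed t)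

end Mollification

/-! ### Positivity -/

section Positivity

variable {n : ℕ}

theorem IsPSH.toReal_le_integral {Ω : Opens (HSpace n)} {u : HSpace n → EReal} (hu : IsPSH Ω u)
    {a v : HSpace n} (hΩ : ∀ t : ℍ[ℝ], ‖t‖ ≤ 1 → a + rmul v t ∈ Ω) (ha : u a ≠ ⊥) :
    (u a).toReal ≤ ∫ ξ, (u (a + rmul v ξ)).toReal ∂sphereProb := by
  obtain ⟨w, hwm, huw, hw⟩ := hu.exists_measurable_eqOn
  have hsphere (ξ : sphere (0 : ℍ[ℝ]) 1) : ‖(ξ : ℍ[ℝ])‖ ≤ 1 := (norm_eq_of_mem_sphere ξ).le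
  have haΩ : a ∈ Ω := by simpa only [map_zero, add_zero] using hΩ 0 (by simp)
  simp only [huw haΩ, huw (hΩ _ (hsphere _))] at ha ⊢
  have hK : IsCompact ((fun t => a + rmul v t) '' closedBall 0 1) :=
    (isCompact_closedBall _ _).image (by fun_prop)
  obtain ⟨M, hM₀, hM⟩ := hw.exists_forall_le_of_isCompact hK
    (Set.image_subset_iff.2 fun t ht => hΩ t (mem_closedBall_zero_iff.1 ht))
  have hwM (t : ℍ[ℝ]) (ht : ‖t‖ ≤ 1) : w (a + rmul v t) ≤ M :=
    hM _ ⟨t, mem_closedBall_zero_iff.2 ht, rfl⟩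
  have haM : w a ≤ M := by simpa only [map_zero, add_zero] using hwM 0 (by simp)
  have hgap := hw.lintegral_gap_sphere_le hwm hM₀ hΩ hwM
  have hatop : gap M w a ≠ ⊤ := gap_eq_top_iff.not.2 ha
  have hint := integral_toReal_eq_sub_lintegral_gap
    (f := fun ξ : sphere (0 : ℍ[ℝ]) 1 => w (a + rmul v ξ))
    (hwm.comp (by fun_prop)) (ae_of_all sphereProb fun ξ => hwM ξ (hsphere ξ))
    (ne_top_of_le_ne_top hatop hgap)
  rw [hint, probReal_univ, one_mul, toReal_eq_sub_gap haM ha]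
  exact sub_le_sub_left (ENNReal.toReal_mono hatop hgap) M

theorem IsPSH.mollify_le_integral {Ω : Opens (HSpace n)} {u : HSpace n → EReal} (hu : IsPSH Ω u)
    (hfin : ∀ᵐ q ∂volume.restrict (Ω : Set (HSpace n)), u q ≠ ⊥) {w : HSpace n → ℝ}
    (hw : Integrable w) {x v : HSpace n} {δ : ℝ} {φ : ContDiffBump (0 : HSpace n)}
    (hδ : φ.rOut + ‖v‖ < δ) (hΩ : ball x δ ⊆ Ω)
    (hwu : Set.EqOn w (fun q => (u q).toReal) (ball x δ)) :
    mollify φ volume w x ≤ ∫ ξ, mollify φ volume w (x + rmul v ξ) ∂sphereProb := by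
  refine mollify_le_integral_mollify hw (T := fun ξ : sphere (0 : ℍ[ℝ]) 1 => rmul v ξ)
    (by fun_prop) ?_
  rw [ae_restrict_iff' Ω.isOpen.measurableSet] at hfin
  filter_upwards [(Measure.measurePreserving_sub_left volume x).quasiMeasurePreserving.ae hfin]
    with t hut htφ
  have hmem (s : ℍ[ℝ]) (hs : ‖s‖ ≤ 1) : x - t + rmul v s ∈ ball x δ := by
    refine ball_subset_ball' (ε₁ := δ - ‖t‖) ?_ (add_rmul_mem_ball (by linarith) hs)
    rw [dist_eq_norm, sub_sub_cancel_left, norm_neg, sub_add_cancel]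
  have hcenter : x - t ∈ ball x δ := by simpa only [map_zero, add_zero] using hmem 0 (by simp)
  simp only [hwu hcenter, hwu (hmem _ (norm_eq_of_mem_sphere _).le)]
  exact hu.toReal_le_integral (fun s hs => hΩ (hmem s hs)) (hut (hΩ hcenter))

theorem isStronglyPositive_bastonElement_hessianForm (hn : 1 ≤ n) {g : HSpace n → ℝ}
    {x : HSpace n} (hg : ContDiffAt ℝ 2 g x)
    (hmean : ∀ v, ∀ᶠ r : ℝ in 𝓝[>] 0, g x ≤ ∫ ξ, g (x + rmul (r • v) ξ) ∂sphereProb) :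
    IsStronglyPositive 1 (bastonElement (hessianForm g x)) :=
  isStronglyPositive_bastonElement hn (isSymm_hessianForm hg) fun v => by
    simp only [hessianForm_apply]
    refine sum_sndFDeriv_nonneg_of_le_integral hg (rmul v) ?_
    simpa only [map_smul, smul_apply] using hmean v

theorem eventually_norm_smul_lt {E : Type*} [SeminormedAddCommGroup E] [NormedSpace ℝ E]
    (v : E) {δ : ℝ} (hδ : 0 < δ) : ∀ᶠ r : ℝ in 𝓝 0, ‖r • v‖ < δ :=
  (Continuous.tendsto' (by fun_prop) 0 0 (by simp)).eventually_lt_const hδ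

theorem IsPSH.isStronglyPositive_bastonForm (hn : 1 ≤ n) {Ω : Opens (HSpace n)}
    {v : HSpace n → ℝ} (hv : IsPSH Ω fun q => (v q : EReal)) (hc : ContDiffOn ℝ 2 v Ω)
    {q : HSpace n} (hq : q ∈ Ω) : IsStronglyPositive 1 (toExt (bastonForm v q)) := by
  have hvq : ContDiffAt ℝ 2 v q := hc.contDiffAt (Ω.isOpen.mem_nhds hq)
  obtain ⟨δ, hδ, hsub⟩ := isOpen_iff.1 Ω.isOpen q hq
  rw [toExt_bastonForm hvq]
  refine isStronglyPositive_bastonElement_hessianForm hn hvq fun x => ?_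
  filter_upwards [nhdsWithin_le_nhds (eventually_norm_smul_lt x hδ)] with r hr
  exact hv.toReal_le_integral (fun t ht => hsub (add_rmul_mem_ball hr ht)) (EReal.coe_ne_bot _)

theorem integral_ofReal_mul_dForm_dForm_nonneg (hn : 1 ≤ n) {g : HSpace n → ℝ} {p k m : ℕ}
    (h : k + 1 = m) (h' : p + 1 = k) {η : HSpace n → ExtPow n p} (hη : ContDiff ℝ 2 η)
    (hc : HasCompactSupport η) (hpos : ∀ q, IsStronglyPositive (n - 1) (toExt (η q)))
    (hg : ∀ x ∈ tsupport η, ContDiffAt ℝ 2 g x)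
    (hmean : ∀ x ∈ tsupport η, ∀ v, ∀ᶠ r : ℝ in 𝓝[>] 0,
      g x ≤ ∫ ξ, g (x + rmul (r • v) ξ) ∂sphereProb) :
    0 ≤ ∫ q, (g q : ℂ) * topCoeff n (toExt (dForm 0 h (dForm 1 h' η) q)) := by
  rw [integral_ofReal_mul_dForm_dForm h h' hg hη hc]
  refine integral_nonneg fun x => ?_
  by_cases hx : x ∈ tsupport η
  · exact topCoeff_mul_nonneg (Nat.add_sub_cancel' hn)
      (isStronglyPositive_bastonElement_hessianForm hn (hg x hx) (hmean x hx)) (hpos x)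
  · simp only [image_eq_zero_of_notMem_tsupport hx, map_zero, mul_zero, Pi.zero_apply, le_refl]

theorem IsPSH.integral_mollify_indicator_nonneg (hn : 1 ≤ n) {Ω : Opens (HSpace n)}
    {u : HSpace n → EReal} (hu : IsPSH Ω u)
    (hfin : ∀ᵐ q ∂volume.restrict (Ω : Set (HSpace n)), u q ≠ ⊥) {K : Set (HSpace n)}
    (hKΩ : K ⊆ Ω) (hw : Integrable (K.indicator fun q => (u q).toReal)) {p k m : ℕ}
    (h : k + 1 = m) (h' : p + 1 = k) {η : HSpace n → ExtPow n p} (hη : ContDiff ℝ 2 η)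
    (hc : HasCompactSupport η) (hpos : ∀ q, IsStronglyPositive (n - 1) (toExt (η q))) {δ : ℝ}
    (hK : ∀ x ∈ tsupport η, ball x δ ⊆ K) {φ : ContDiffBump (0 : HSpace n)}
    (hφ : φ.rOut < δ) :
    0 ≤ ∫ q, ((mollify φ volume (K.indicator fun q => (u q).toReal) q : ℝ) : ℂ) *
      topCoeff n (toExt (dForm 0 h (dForm 1 h' η) q)) := by
  refine integral_ofReal_mul_dForm_dForm_nonneg hn h h' hη hc hpos
    (fun x _ => (contDiff_mollify (k := 2) hw.locallyIntegrable).contDiffAt) fun x hx v => ?_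
  filter_upwards [nhdsWithin_le_nhds (eventually_norm_smul_lt v (sub_pos.2 hφ))]
    with r hr
  exact hu.mollify_le_integral hfin hw (lt_sub_iff_add_lt'.1 hr) ((hK x hx).trans hKΩ)
    ((Set.eqOn_indicator (f := fun q => (u q).toReal)).mono (hK x hx))

theorem exists_contDiffBump_tendsto_rOut {E : Type*} [NormedAddCommGroup E] :
    ∃ ψ : ℕ → ContDiffBump (0 : E), Tendsto (fun i => (ψ i).rOut) atTop (𝓝 0) :=
  ⟨fun i => ⟨1 / (i + 1) / 2, 1 / (i + 1), by positivity, half_lt_self (by positivity)⟩,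
    tendsto_one_div_add_atTop_nhds_zero_nat⟩

theorem IsPSH.integral_toReal_mul_dTest_dTest_nonneg (hn : 1 ≤ n) {Ω : Opens (HSpace n)}
    {u : HSpace n → EReal} (hu : IsPSH Ω u)
    (hfin : ∀ᵐ q ∂volume.restrict (Ω : Set (HSpace n)), u q ≠ ⊥)
    (hloc : LocallyIntegrableOn (fun q => (u q).toReal) (Ω : Set (HSpace n))) {p k m : ℕ}
    (h : k + 1 = m) (h' : p + 1 = k) (η : TestForm Ω p)
    (hpos : ∀ q, IsStronglyPositive (n - 1) (toExt (η q))) :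
    0 ≤ ∫ q, ((u q).toReal : ℂ) * topCoeff n (toExt (dTest 0 h (dTest 1 h' η) q)) := by
  have hηc := η.hasCompactSupport
  obtain ⟨δ, hδ, hKΩ⟩ :=
    hηc.isCompact.exists_cthickening_subset_open Ω.isOpen η.tsupport_subset
  set K := cthickening δ (tsupport η)
  have hKc : IsCompact K := hηc.isCompact.cthickening
  have hball : ∀ x ∈ tsupport η, ball x δ ⊆ K := fun x hx =>
    (ball_subset_thickening hx δ).trans (thickening_subset_cthickening _ _)
  have hw : Integrable (K.indicator fun q => (u q).toReal) :=
    (hloc.integrableOn_compact_subset hKΩ hKc).integrable_indicator hKc.measurableSet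
  let L : ExtPow n m →ₗ[ℂ] ℂ := topCoeff n ∘ₗ toExt
  let ζ := dTest 0 h (dTest 1 h' η)
  have hLζ : tsupport (fun q => L (ζ q)) ⊆ K := calc
    tsupport (fun q => L (ζ q)) ⊆ tsupport ζ := tsupport_comp_subset (map_zero L) ζ
    _ ⊆ tsupport η := by
      simpa only [ζ, coe_dTest] using tsupport_dForm_subset.trans tsupport_dForm_subset
    _ ⊆ K := self_subset_cthickening _
  obtain ⟨ψ, hψ⟩ := exists_contDiffBump_tendsto_rOut (E := HSpace n)
  have hlim := tendsto_integral_mollify_indicator_smul hψ hw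
    (L.continuous_of_finiteDimensional.comp ζ.continuous)
    (ζ.hasCompactSupport.comp_left (map_zero L)) hLζ
  simp only [Complex.real_smul] at hlim
  refine ge_of_tendsto hlim ?_
  filter_upwards [hψ.eventually_lt_const hδ] with i hi
  simp only [ζ, coe_dTest]
  exact hu.integral_mollify_indicator_nonneg hn hfin hKΩ hw h h' (contDiff_two_testForm η) hηc
    hpos hball hi

theorem IsPSH.isPositiveCurrent_bastonCurrent (hn : 1 ≤ n) (h : 0 + 2 ≤ 2 * n)
    {Ω : Opens (HSpace n)} {u : HSpace n → EReal} (hu : IsPSH Ω u)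
    (hfin : ∀ᵐ q ∂volume.restrict (Ω : Set (HSpace n)), u q ≠ ⊥)
    (hloc : LocallyIntegrableOn (fun q => (u q).toReal) (Ω : Set (HSpace n))) :
    IsPositiveCurrent 1
      (bastonCurrent h (functionCurrent Ω fun q => ((u q).toReal : ℂ))) := fun η hη => by
  have hnonneg := hu.integral_toReal_mul_dTest_dTest_nonneg hn hfin hloc
    (show (2 * n - (0 + 2) + 1) + 1 = 2 * n - 0 by omega) rfl η hη
  rw [Complex.nonneg_iff] at hnonneg
  rw [bastonCurrent_functionCurrent_apply h (locallyIntegrableOn_ofReal hloc)]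
  simp only [coe_dTest] at hnonneg
  exact ⟨hnonneg.1, hnonneg.2.symm⟩

end Positivity

end QPot

end

theorem proposition3p6 (n : ℕ) (hn : 1 ≤ n) (Ω : Opens (HSpace n)) :
    (∀ u : HSpace n → EReal, IsPSH Ω u →
      (∀ a ∈ Ω, ∃ q ∈ connectedComponentIn (Ω : Set (HSpace n)) a, u q ≠ ⊥) →
      (∀ᵐ q ∂volume.restrict (Ω : Set (HSpace n)), u q ≠ ⊥) ∧
      ∃ U : Current Ω 0, IsCurrentOf U (scalarForm fun q => ((u q).toReal : ℂ)) ∧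
        IsClosedCurrent (bastonCurrent (by omega) U) ∧
        IsPositiveCurrent 1 (bastonCurrent (by omega) U)) ∧
    (∀ v : HSpace n → ℝ, IsPSH Ω (fun q => (v q : EReal)) →
      ContDiffOn ℝ 2 v (Ω : Set (HSpace n)) →
      (∀ q ∈ Ω, IsStronglyPositive 1 (toExt (bastonForm v q))) ∧
      (∃ V : Current Ω 0, IsCurrentOf V (scalarForm fun q => (v q : ℂ)) ∧
        IsCurrentOf (bastonCurrent (by omega) V) (bastonForm v) ∧
        IsClosedCurrent (bastonCurrent (by omega) V)) ∧
      (ContDiffOn ℝ 3 v (Ω : Set (HSpace n)) →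
        ∀ α, ∀ q ∈ Ω, dForm α rfl (bastonForm v) q = (0 : ExtPow n 3))) := by
  refine ⟨fun u hu hne => ?_, fun v hv hc => ⟨fun q hq => hv.isStronglyPositive_bastonForm hn hc hq,
    ⟨functionCurrent Ω _, isCurrentOf_functionCurrent ?_,
      isCurrentOf_bastonCurrent_functionCurrent _ hc, isClosedCurrent_bastonCurrent _ _⟩,
    fun hc3 α q hq => ?_⟩⟩
  · have hlocus := hu.subset_integrableLocus hne
    have hfin := ae_restrict_ne_bot_of_subset_integrableLocus hlocus
    have hloc := locallyIntegrableOn_toReal_of_subset_integrableLocus hlocus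
    exact ⟨hfin, functionCurrent Ω _,
      isCurrentOf_functionCurrent (locallyIntegrableOn_ofReal hloc),
      isClosedCurrent_bastonCurrent _ _, hu.isPositiveCurrent_bastonCurrent hn _ hfin hloc⟩
  · exact locallyIntegrableOn_ofReal
      (hc.continuousOn.locallyIntegrableOn Ω.isOpen.measurableSet)
  · exact dForm_dForm_dForm _ _ _
      (contDiffAt_scalarForm (hc3.contDiffAt (Ω.isOpen.mem_nhds hq))) α
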